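/- Setting. Let $\Theta\subseteq\mathbb R^p$ be convex and let $\xi=(x,y)$, $x\in\mathbb R^p$, be a random data point with law $P$. The loss has the linear-predictor form $L(\theta,\xi)=L(x^\top\theta,y)$; it is integrable for each $\theta\in\Theta$ and, almost surely, twice differentiable in $\theta$ at every point of $\Theta$. Write $\ell(\theta)=\mathbb E\,L(\theta,\xi)$ and let $\theta_\star$, an interior point of $\Theta$, minimize $\ell$ over $\Theta$. Let $\xi_1,\xi_2,\dots$ be i.i.d. copies of $\xi$, independent of $\theta_0$, and consider averaged implicit SGD $$\theta_n=\theta_{n-1}-\gamma_n\nabla L(\theta_n,\xi_n),\qquad \bar\theta_n=\frac1n\sum_{i=1}^n\theta_i,\qquad \theta_n\in\Theta \text{ a.s.},$$ where $\theta_n$ is adapted to the history $\theta_0,\xi_1,\dots,\xi_n$ and $\gamma_n=\gamma_1n^{-\gamma}$ with $\gamma_1>0$, $\gamma\in(1/2,1)$. Assumptions. (i) Almost surely, for all $\theta_1,\theta_2\in\Theta$, $|L(\theta_1,\xi)-L(\theta_2,\xi)|\le\lambda_0\|\theta_1-\theta_2\|$ and $\|\nabla^2L(\theta_1,\xi)-\nabla^2L(\theta_2,\xi)\|\le\lambda_2\|\theta_1-\theta_2\|$.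 (ii) There are $0<\lambda_f\le\phi$ such that $\mathrm{trace}(\nabla^2L(\theta,\xi))\ge\phi$ for all $\theta\in\Theta$ almost surely, and $\mathbb E\,\nabla^2L(\theta,\xi)\succeq\lambda_fI$ for all $\theta\in\Theta$. (iii) $W_\theta=\nabla L(\theta,\xi)-\nabla\ell(\theta)$ is square-integrable for $\theta$ in the interior of $\Theta$, and $\mathbb E(W_{\theta_\star}W_{\theta_\star}^\top)\preceq\Sigma$ for a fixed positive-definite matrix $\Sigma$. Conclusion. Let $H=\nabla^2\ell(\theta_\star)$, $\delta_0=\mathbb E\|\theta_0-\theta_\star\|^2$, $\varepsilon=(1+\gamma_1(\phi-\lambda_f))^{-1}$ and $\lambda=1+\gamma_1\lambda_f\varepsilon$. Then $\lambda>1$, and there are constants $C_1,C_2,C_3$, depending neither on $n$ nor on the initial condition $\theta_0$, such that $\delta_0<\infty$ and, for every $n\ge1$, $$\big(\mathbb E\|\bar\theta_n-\theta_\star\|^2\big)^{1/2}\le\frac1{\sqrt n}\big(\mathrm{trace}(H^{-1}\Sigma H^{-1})\big)^{1/2}+C_1n^{-1+\gamma/2}+C_2n^{-\gamma}+C_3\,\delta_0^{1/2}\exp\!\big(-\tfrac12\log\lambda\cdot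 n^{1-\gamma}\big),$$ with a finite left-hand side. Moreover: (a) If the model is correctly specified, i.e. there is a measure $\nu$ such that $e^{-L(\theta,\cdot)}$ is a probability density with respect to $\nu$ for all $\theta$ near $\theta_\star$, and $P$ has density $e^{-L(\theta_\star,\cdot)}$, then the Fisher information $I(\theta_\star)=\mathbb E[\nabla L(\theta_\star,\xi)\nabla L(\theta_\star,\xi)^\top]$ equals $H$, and for $\Sigma=\mathbb E(W_{\theta_\star}W_{\theta_\star}^\top)$ the leading term equals the square root of the Cramér–Rao bound $\mathrm{trace}\big((nI(\theta_\star))^{-1}\big)$. (b) The exponent $2/3$ is optimal for the remaining rates: for every $g\in(1/2,1)$ with $g\ne2/3$, $n^{-1+(2/3)/2}+n^{-2/3}=o\big(n^{-1+g/2}+n^{-g}\big)$ as $n\to\infty$. -/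

import Mathlib

open MeasureTheory ProbabilityTheory Filter Asymptotics Topology

noncomputable section

namespace AISGD

/-- The parameter vectors: `ℝᵖ` with the Euclidean norm. -/
abbrev Param (p : ℕ) : Type := EuclideanSpace ℝ (Fin p)

variable {p : ℕ} {Y : Type*} [MeasurableSpace Y]

/-- The loss `L(θ, ξ) = f(xᵀθ, y)` at a data point `ξ = (x, y)`: it depends on `θ` only through
the linear predictor `xᵀθ`. -/
def loss (f : ℝ → Y → ℝ) (θ : Param p) (ξ : Param p × Y) : ℝ :=
  f (inner ℝ ξ.1 θ) ξ.2

/-- The gradient `∇L(θ, ξ)` in `θ`. -/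
def lossGrad (f : ℝ → Y → ℝ) (θ : Param p) (ξ : Param p × Y) : Param p :=
  gradient (fun t => loss f t ξ) θ

/-- The expected loss `ℓ(θ) = E L(θ, ξ)`, where `ξ` has law `P`. -/
def expectedLoss (f : ℝ → Y → ℝ) (P : Measure (Param p × Y)) (θ : Param p) : ℝ :=
  ∫ ξ, loss f θ ξ ∂P

/-- The Hessian `∇²g(θ)` as a linear operator, the derivative of the gradient. -/
def hessianOp (g : Param p → ℝ) (θ : Param p) : Param p →L[ℝ] Param p :=
  fderiv ℝ (gradient g) θ

/-- The matrix of the Hessian `∇²g(θ)` in the standard basis. -/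
def hessianMat (g : Param p → ℝ) (θ : Param p) : Matrix (Fin p) (Fin p) ℝ :=
  Matrix.of fun i j => hessianOp g θ (EuclideanSpace.single j 1) i

/-- The gradient noise `W_θ = ∇L(θ, ξ) - ∇ℓ(θ)`. -/
def gradNoise (f : ℝ → Y → ℝ) (P : Measure (Param p × Y)) (θ : Param p) (ξ : Param p × Y) :
    Param p :=
  lossGrad f θ ξ - gradient (expectedLoss f P) θ

/-- The matrix `E (W_θ W_θᵀ)`. -/
def noiseCov (f : ℝ → Y → ℝ) (P : Measure (Param p × Y)) (θ : Param p) :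
    Matrix (Fin p) (Fin p) ℝ :=
  Matrix.of fun i j => ∫ ξ, gradNoise f P θ ξ i * gradNoise f P θ ξ j ∂P

/-- The assumptions on the estimation problem: parameter space `Θ`, loss `L(θ, ξ) = f(xᵀθ, y)`,
law `P` of the data point `ξ = (x, y)`, target `θs`. -/
structure Assumptions (Θ : Set (Param p)) (f : ℝ → Y → ℝ) (P : Measure (Param p × Y))
    (θs : Param p) (S : Matrix (Fin p) (Fin p) ℝ) (lam0 lam2 lamf φ : ℝ) : Prop where
  convex_space : Convex ℝ Θ
  measurable_loss : Measurable (Function.uncurry f)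
  /-- The expected loss is defined on `Θ`. -/
  integrable_loss : ∀ θ ∈ Θ, Integrable (loss f θ) P
  /-- `θs` minimizes the expected loss over `Θ`, and it is an interior point of `Θ`. -/
  target_interior : θs ∈ interior Θ
  target_min : IsMinOn (expectedLoss f P) Θ θs
  /-- The loss is almost surely twice differentiable in the parameter. -/
  differentiable : ∀ᵐ ξ ∂P, ∀ θ ∈ Θ, DifferentiableAt ℝ (fun t => loss f t ξ) θ
  twice_differentiable : ∀ᵐ ξ ∂P, ∀ θ ∈ Θ, DifferentiableAt ℝ (gradient fun t => loss f t ξ) θ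
  /-- The loss is almost surely Lipschitz. -/
  lipschitz_loss : ∀ᵐ ξ ∂P, ∀ θ₁ ∈ Θ, ∀ θ₂ ∈ Θ,
    |loss f θ₁ ξ - loss f θ₂ ξ| ≤ lam0 * ‖θ₁ - θ₂‖
  /-- The Hessian of the loss is almost surely Lipschitz. -/
  lipschitz_hessian : ∀ᵐ ξ ∂P, ∀ θ₁ ∈ Θ, ∀ θ₂ ∈ Θ,
    ‖hessianOp (fun t => loss f t ξ) θ₁ - hessianOp (fun t => loss f t ξ) θ₂‖
      ≤ lam2 * ‖θ₁ - θ₂‖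
  /-- The observed Fisher information `∇²L(θ, ξ)` has trace at least `φ`, almost surely. -/
  trace_lower : ∀ᵐ ξ ∂P, ∀ θ ∈ Θ, φ ≤ (hessianMat (fun t => loss f t ξ) θ).trace
  /-- The expected Fisher information `E ∇²L(θ, ξ)` has smallest eigenvalue at least `lamf`. -/
  fisher_lower : ∀ θ ∈ Θ, ∀ v : Param p,
    lamf * ‖v‖ ^ 2 ≤ inner ℝ v ((∫ ξ, hessianOp (fun t => loss f t ξ) θ ∂P) v)
  lamf_pos : 0 < lamf
  lamf_le : lamf ≤ φ
  /-- The gradient noise is square integrable; its covariance at `θs` is at most `S`. -/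
  noise_sq : ∀ θ ∈ interior Θ, MemLp (gradNoise f P θ) 2 P
  S_posDef : S.PosDef
  noise_le : (S - noiseCov f P θs).PosSemidef

/-- The learning rate `γₙ = γ₁ n^{-γ}`. -/
def rate (γ1 γ : ℝ) (n : ℕ) : ℝ := γ1 * (n : ℝ) ^ (-γ)

/-- `θ₀, θ₁, …` are iterates of implicit SGD on the i.i.d. data stream `ξ₁, ξ₂, …` of law `P`:
`θₙ = θₙ₋₁ - γₙ ∇L(θₙ, ξₙ)`, with `θₙ ∈ Θ`. The iterate `θₙ` depends on the past `ℱ n` only,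
and `ξₙ₊₁` is independent of the past (`ξ 0` plays no role). -/
structure IsImplicitSGD (Θ : Set (Param p)) (f : ℝ → Y → ℝ) (P : Measure (Param p × Y))
    (γ1 γ : ℝ) {Ω : Type*} {mΩ : MeasurableSpace Ω} (μ : Measure Ω) (ℱ : Filtration ℕ mΩ)
    (ξ : ℕ → Ω → Param p × Y) (θ : ℕ → Ω → Param p) : Prop where
  data_measurable : ∀ n, Measurable[ℱ (n + 1)] (ξ (n + 1))
  data_law : ∀ n, μ.map (ξ (n + 1)) = P
  data_indep : ∀ n, Indep (MeasurableSpace.comap (ξ (n + 1)) inferInstance) (ℱ n) μ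
  adapted : ∀ n, Measurable[ℱ n] (θ n)
  mem_space : ∀ n, ∀ᵐ ω ∂μ, θ n ω ∈ Θ
  update : ∀ n, ∀ᵐ ω ∂μ,
    θ (n + 1) ω = θ n ω - rate γ1 γ (n + 1) • lossGrad f (θ (n + 1) ω) (ξ (n + 1) ω)

/-- The averaged iterate `(1/n) ∑_{i=1}^n θᵢ`. -/
def average {Ω : Type*} (θ : ℕ → Ω → Param p) (n : ℕ) (ω : Ω) : Param p :=
  (n : ℝ)⁻¹ • ∑ i ∈ Finset.Icc 1 n, θ i ω

/-- The constant `λ = 1 + γ₁ λ_f ε` with `ε = (1 + γ₁ (φ - λ_f))⁻¹`, which governs the decay of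
the initial conditions. -/
def decayConst (γ1 lamf φ : ℝ) : ℝ := 1 + γ1 * lamf * (1 + γ1 * (φ - lamf))⁻¹

/-- The leading term `n^{-1/2} (trace (H⁻¹ S H⁻¹))^{1/2}`. -/
def leadingTerm (H S : Matrix (Fin p) (Fin p) ℝ) (n : ℕ) : ℝ :=
  (n : ℝ) ^ (-(1 / 2) : ℝ) * Real.sqrt (H⁻¹ * S * H⁻¹).trace

/-- The order `n^{-1+γ/2} + n^{-γ}` of the remaining terms. -/
def remainderOrder (γ : ℝ) (n : ℕ) : ℝ := (n : ℝ) ^ (-1 + γ / 2) + (n : ℝ) ^ (-γ)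

/-- The loss is the negative log-likelihood of a correctly specified model: for `θ` near `θs`
the functions `exp (-L(θ, ·))` are probability densities with respect to `ν`, and the data have
the density with parameter `θs`. -/
structure WellSpecified (f : ℝ → Y → ℝ) (P : Measure (Param p × Y)) (θs : Param p)
    (ν : Measure (Param p × Y)) : Prop where
  normalized : ∀ᶠ θ in 𝓝 θs, ∫ ξ, Real.exp (-loss f θ ξ) ∂ν = 1
  data_density : P = ν.withDensity fun ξ => ENNReal.ofReal (Real.exp (-loss f θs ξ))

/-- The Fisher information matrix of one observation in the model with densities
`exp (-L(θ, ·))`: the second moment matrix of the score `-∇L(θ, ξ)`. -/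
def fisherInfo (f : ℝ → Y → ℝ) (ν : Measure (Param p × Y)) (θ : Param p) :
    Matrix (Fin p) (Fin p) ℝ :=
  Matrix.of fun i j =>
    ∫ ξ, (-lossGrad f θ ξ) i * (-lossGrad f θ ξ) j * Real.exp (-loss f θ ξ) ∂ν

/-- The Cramér–Rao lower bound `trace ((n I)⁻¹)` for the mean squared error of unbiased
estimators from `n` observations with Fisher information `I` each. -/
def cramerRaoBound (I : Matrix (Fin p) (Fin p) ℝ) (n : ℕ) : ℝ := (((n : ℝ) • I)⁻¹).trace

end AISGD

end

/-!
The argument rests on the fact that `Θ` is bounded. By assumption the expected loss is Lipschitz on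
`Θ`, and its Hessian `E ∇²L` is bounded below, so that it grows at least quadratically around its
minimizer (`Assumptions.expectedLoss_growth`, `Assumptions.norm_sub_target_le`). Hence all iterates,
and in particular all initial conditions, are bounded by one constant.

A loss with linear predictor has a Hessian of rank one (`exists_hessianOp_loss_eq`), so the lower
bound on its trace makes each single loss convex. With the subgradient inequality at the new iterate,
one step of implicit SGD satisfies
`‖θₙ₊₁ - θs‖² ≤ ‖θₙ - θs‖² - 2 γₙ₊₁ (L(θₙ, ξₙ₊₁) - L(θs, ξₙ₊₁)) + O(γₙ₊₁²)`,
where the loss difference is evaluated at the old iterate, which is independent of `ξₙ₊₁`. Squaring,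
averaging over `ξₙ₊₁` and the quadratic growth give a recursion for the fourth moments of the error,
which are therefore `O(n^{-2γ})` (`Assumptions.exists_fourth_moment_le`).

For the averages the recursion is linearized at `θs` (`error_decomposition`). With
`H = ∇²ℓ(θs)`, `M = ∇²L(θs, ξₙ₊₁)` and the errors `b = θₙ - θs`, `b' = θₙ₊₁ - θs`, the vector `H b'`
is the sum of
* `-∇L(θs, ξₙ₊₁)`, i.i.d. and centered, which yields the leading term
  (`IsImplicitSGD.lpNorm_sum_centered_le`);
* `(b - b') / γₙ₊₁`, whose sum is of order `n^{γ/2}` by summation by parts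
  (`lpNorm_sum_inv_rate_smul_sub_le`);
* `-(M - H) b`, a martingale difference, whose sum is of order `n^{(1-γ)/2}`
  (`IsImplicitSGD.lpNorm_sum_clm_apply_le`);
* an error of the order of `γₙ₊₁ + ‖b'‖²`, whose sum is of order `n^{1-γ}`
  (`IsImplicitSGD.lpNorm_sum_linearizationError_le`); the fourth moments are needed here.

Applying `H⁻¹` and dividing by `n` gives the bound. The initial error is bounded because `Θ` is, and
its contribution to the average is `O(1/n)`, so the second term covers it: the bound holds even
without the exponentially decaying term.

In a correctly specified model, the identity `∫ e^{-L(θ, ·)} dν = 1` is differentiated twice at `θs`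
under the integral; the result is that the Fisher information is the Hessian of the expected loss
(`Assumptions.fisherInfo_eq_hessianMat`).
-/

namespace AISGD

/-! ### Power sums and the recursion for the moments -/

/-- Bernoulli's inequality for the increments of a concave power. -/
lemma rpow_sub_one_mul_le_sub {s : ℝ} (hs : 0 ≤ s) (hs1 : s ≤ 1) (n : ℕ) :
    s * ((n : ℝ) + 1) ^ (s - 1) ≤ ((n : ℝ) + 1) ^ s - (n : ℝ) ^ s := by
  have hn : (0 : ℝ) < (n : ℝ) + 1 := by positivity
  have h1 : (-1 : ℝ) ≤ -(1 / ((n : ℝ) + 1)) := by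
    rw [neg_le_neg_iff, div_le_one hn]
    linarith [n.cast_nonneg (α := ℝ)]
  have h := rpow_one_add_le_one_add_mul_self h1 hs hs1
  have h2 : (1 + -(1 / ((n : ℝ) + 1))) = (n : ℝ) / ((n : ℝ) + 1) := by
    field_simp
    ring
  rw [h2, Real.div_rpow n.cast_nonneg hn.le, div_le_iff₀ (by positivity)] at h
  rw [Real.rpow_sub_one hn.ne']
  have h3 : (1 + s * -(1 / ((n : ℝ) + 1))) * ((n : ℝ) + 1) ^ s
      = ((n : ℝ) + 1) ^ s - s * (((n : ℝ) + 1) ^ s / ((n : ℝ) + 1)) := by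
    field_simp
    ring
  linarith

lemma sum_rpow_sub_one_le {s : ℝ} (hs : 0 < s) (hs1 : s ≤ 1) (n : ℕ) :
    ∑ i ∈ Finset.range n, ((i : ℝ) + 1) ^ (s - 1) ≤ (n : ℝ) ^ s / s := by
  induction n with
  | zero => simp [Real.zero_rpow hs.ne']
  | succ n ih =>
    rw [Finset.sum_range_succ]
    have h := rpow_sub_one_mul_le_sub hs.le hs1 n
    have h2 : ((n : ℝ) + 1) ^ (s - 1) ≤ (((n : ℝ) + 1) ^ s - (n : ℝ) ^ s) / s := by
      rw [le_div_iff₀ hs]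
      linarith
    push_cast
    rw [sub_div] at h2
    linarith

/-- The increments of a concave power, bounded from above. -/
lemma rpow_succ_sub_le {s : ℝ} (hs : 0 ≤ s) (hs1 : s ≤ 1) {n : ℕ} (hn : 1 ≤ n) :
    ((n : ℝ) + 1) ^ s - (n : ℝ) ^ s ≤ (n : ℝ) ^ (s - 1) := by
  have hn0 : (0 : ℝ) < n := by exact_mod_cast hn
  have h1 : (-1 : ℝ) ≤ 1 / (n : ℝ) := by
    have : (0 : ℝ) ≤ 1 / (n : ℝ) := by positivity
    linarith
  have h := rpow_one_add_le_one_add_mul_self h1 hs hs1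
  have h2 : (1 + 1 / (n : ℝ)) = ((n : ℝ) + 1) / n := by field_simp
  rw [h2, Real.div_rpow (by positivity) hn0.le, div_le_iff₀ (by positivity)] at h
  rw [Real.rpow_sub_one hn0.ne']
  have h4 : s * ((n : ℝ) ^ s / n) ≤ 1 * ((n : ℝ) ^ s / n) := by gcongr
  have h3 : (1 + s * (1 / (n : ℝ))) * (n : ℝ) ^ s = (n : ℝ) ^ s + s * ((n : ℝ) ^ s / n) := by
    field_simp
  linarith

lemma rate_succ (γ1 γ : ℝ) (n : ℕ) : rate γ1 γ (n + 1) = γ1 * ((n : ℝ) + 1) ^ (-γ) := by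
  simp [rate]

lemma rate_succ_pos {γ1 : ℝ} (γ : ℝ) (h1 : 0 < γ1) (n : ℕ) : 0 < rate γ1 γ (n + 1) := by
  rw [rate_succ]
  positivity

lemma rate_succ_le {γ1 γ : ℝ} (h1 : 0 < γ1) (hγ : 0 ≤ γ) (n : ℕ) :
    rate γ1 γ (n + 1) ≤ γ1 := by
  rw [rate_succ]
  have : ((n : ℝ) + 1) ^ (-γ) ≤ 1 :=
    Real.rpow_le_one_of_one_le_of_nonpos (by linarith [n.cast_nonneg (α := ℝ)]) (by linarith)
  nlinarith

/-- A bounded sequence with `u (n+1) ≤ (1 - c γₙ₊₁) u n + C γₙ₊₁³` decays like `γₙ²`, with a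
constant that depends on the sequence only through its bound. -/
lemma exists_decay_of_recursion {c C B γ1 γ : ℝ} (hc : 0 < c) (hC : 0 ≤ C) (hB : 0 ≤ B)
    (h1 : 0 < γ1) (hγ : γ ∈ Set.Ioo (1 / 2 : ℝ) 1) :
    ∃ A : ℝ, 0 ≤ A ∧ ∀ u : ℕ → ℝ, (∀ n, u n ≤ B) →
      (∀ n, u (n + 1) ≤ (1 - c * rate γ1 γ (n + 1)) * u n + C * rate γ1 γ (n + 1) ^ 3) →
      ∀ n, 1 ≤ n → u n ≤ A * (n : ℝ) ^ (-(2 * γ)) := by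
  obtain ⟨hγ0, hγ2⟩ := hγ
  have hcast : Tendsto (fun n : ℕ => (n : ℝ) + 1) atTop atTop :=
    tendsto_natCast_atTop_atTop.atTop_add tendsto_const_nhds
  have hr : Tendsto (fun n : ℕ => c * rate γ1 γ (n + 1)) atTop (𝓝 (c * (γ1 * 0))) := by
    simp only [rate_succ]
    exact (((tendsto_rpow_neg_atTop (by linarith : 0 < γ)).comp hcast).const_mul γ1).const_mul c
  have hr2 : Tendsto (fun n : ℕ => c / 2 * γ1 * ((n : ℝ) + 1) ^ (1 - γ)) atTop atTop :=
    ((tendsto_rpow_atTop (by linarith : 0 < 1 - γ)).comp hcast).const_mul_atTop (by positivity)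
  have hev : ∀ᶠ n : ℕ in atTop, 1 ≤ n ∧ c * rate γ1 γ (n + 1) ≤ 1 ∧
      6 ≤ c / 2 * γ1 * ((n : ℝ) + 1) ^ (1 - γ) := by
    refine (eventually_ge_atTop 1).and ((hr.eventually_le_const (by simp)).and
      (hr2.eventually_ge_atTop 6))
  obtain ⟨n0, hn0⟩ := eventually_atTop.1 hev
  have hn01 : 1 ≤ n0 := (hn0 n0 le_rfl).1
  set A : ℝ := max (2 * C * γ1 ^ 2 / c) (B * (n0 : ℝ) ^ (2 * γ)) with hA
  have hApos : 0 ≤ A := le_max_of_le_left (by positivity)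
  refine ⟨A, hApos, fun u hu hrec => ?_⟩
  have hsmall : ∀ n, 1 ≤ n → n ≤ n0 → u n ≤ A * (n : ℝ) ^ (-(2 * γ)) := by
    intro n hn hnn
    have hnpos : (0 : ℝ) < n := by exact_mod_cast hn
    have : (n : ℝ) ^ (2 * γ) ≤ (n0 : ℝ) ^ (2 * γ) := by
      apply Real.rpow_le_rpow hnpos.le (by exact_mod_cast hnn) (by linarith)
    rw [Real.rpow_neg hnpos.le, ← div_eq_mul_inv, le_div_iff₀ (by positivity)]
    calc u n * (n : ℝ) ^ (2 * γ) ≤ B * (n0 : ℝ) ^ (2 * γ) := by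
          apply mul_le_mul (hu n) this (by positivity) hB
      _ ≤ A := le_max_right _ _
  intro n hn
  rcases le_total n n0 with h | h
  · exact hsmall n hn h
  induction n, h using Nat.le_induction with
  | base => exact hsmall n0 hn le_rfl
  | succ n hnn ih =>
    obtain ⟨hn1, hcr, h6⟩ := hn0 n hnn
    have ih := ih hn1
    have hnpos : (0 : ℝ) < n := by exact_mod_cast hn1
    have hn1' : (1 : ℝ) ≤ n := by exact_mod_cast hn1
    have hmpos : (0 : ℝ) < (n : ℝ) + 1 := by linarith
    set r := rate γ1 γ (n + 1) with hrdef
    have hrpos : 0 < r := rate_succ_pos γ h1 n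
    set m : ℝ := ((n : ℝ) + 1) ^ (-(2 * γ)) with hm
    have hmp : 0 < m := by positivity
    -- `n^{-2γ} ≤ (1 + 3/n) (n+1)^{-2γ}`
    have hstep : (n : ℝ) ^ (-(2 * γ)) ≤ (1 + 3 / n) * m := by
      have e : (n : ℝ) ^ (-(2 * γ)) = (1 + 1 / (n : ℝ)) ^ (2 * γ) * m := by
        have : (1 + 1 / (n : ℝ)) = ((n : ℝ) + 1) / n := by field_simp
        rw [this, hm, Real.div_rpow hmpos.le hnpos.le, Real.rpow_neg hnpos.le,
          Real.rpow_neg hmpos.le]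
        field_simp
      rw [e]
      gcongr
      calc (1 + 1 / (n : ℝ)) ^ (2 * γ) ≤ (1 + 1 / (n : ℝ)) ^ (2 : ℝ) := by
            apply Real.rpow_le_rpow_of_exponent_le _ (by linarith)
            have : (0 : ℝ) ≤ 1 / (n : ℝ) := by positivity
            linarith
        _ = 1 + 2 * (1 / (n : ℝ)) + (1 / (n : ℝ)) * (1 / (n : ℝ)) := by
            rw [Real.rpow_two]
            ring
        _ ≤ 1 + 2 * (1 / (n : ℝ)) + 1 * (1 / (n : ℝ)) := by
            gcongr
            rw [div_le_one hnpos]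
            exact hn1'
        _ = 1 + 3 / n := by ring
    have h3n : 3 / (n : ℝ) ≤ c / 2 * r := by
      have e : c / 2 * r = c / 2 * γ1 * ((n : ℝ) + 1) ^ (1 - γ) / ((n : ℝ) + 1) := by
        rw [hrdef, rate_succ, show (1 - γ) = -γ + 1 by ring, Real.rpow_add hmpos, Real.rpow_one]
        field_simp
      rw [e, div_le_div_iff₀ hnpos hmpos]
      nlinarith
    have hfac : (1 - c * r) * (1 + 3 / n) ≤ 1 - c / 2 * r := by
      have : 0 ≤ 3 / (n : ℝ) := by positivity
      nlinarith [mul_pos hc hrpos]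
    have hr3 : C * r ^ 3 ≤ A * (c / 2 * r) * m := by
      have e : r ^ 2 = γ1 ^ 2 * m := by
        rw [hrdef, rate_succ, hm, mul_pow, ← Real.rpow_natCast (((n : ℝ) + 1) ^ (-γ)),
          ← Real.rpow_mul hmpos.le]
        congr 2
        push_cast
        ring
      have hA1 : 2 * C * γ1 ^ 2 / c ≤ A := le_max_left _ _
      rw [div_le_iff₀ hc] at hA1
      calc C * r ^ 3 = (2 * C * γ1 ^ 2) * (r * m / 2) := by
            rw [show r ^ 3 = r * r ^ 2 by ring, e]
            ring
        _ ≤ (A * c) * (r * m / 2) := by gcongr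
        _ = A * (c / 2 * r) * m := by ring
    calc u (n + 1) ≤ (1 - c * r) * u n + C * r ^ 3 := hrec n
      _ ≤ (1 - c * r) * (A * ((1 + 3 / n) * m)) + A * (c / 2 * r) * m := by
          have h0 : 0 ≤ 1 - c * r := by linarith
          have : u n ≤ A * ((1 + 3 / n) * m) :=
            ih.trans (mul_le_mul_of_nonneg_left hstep hApos)
          gcongr
      _ = ((1 - c * r) * (1 + 3 / n)) * (A * m) + A * (c / 2 * r) * m := by ring
      _ ≤ (1 - c / 2 * r) * (A * m) + A * (c / 2 * r) * m := by gcongr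
      _ = A * m := by ring
      _ = A * ((n + 1 : ℕ) : ℝ) ^ (-(2 * γ)) := by push_cast; rw [hm]

lemma remainderOrder_two_thirds_isLittleO {g : ℝ} (hg : g ≠ 2 / 3) :
    remainderOrder (2 / 3) =o[atTop] remainderOrder g := by
  have key : ∀ a : ℝ, -(2 / 3) < a → (∀ n : ℕ, (n : ℝ) ^ a ≤ remainderOrder g n) →
      remainderOrder (2 / 3) =o[atTop] remainderOrder g := by
    intro a ha hle
    have h1 : (fun n : ℕ => (n : ℝ) ^ (-(2 / 3) : ℝ)) =o[atTop] fun n : ℕ => (n : ℝ) ^ a := by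
      refine (isLittleO_iff_tendsto' ?_).2 ?_
      · filter_upwards [eventually_ge_atTop 1] with n hn h
        have : (0 : ℝ) < n := by exact_mod_cast hn
        exact absurd h (by positivity)
      · have h := (tendsto_rpow_neg_atTop (by linarith : 0 < a + 2 / 3)).comp
          (tendsto_natCast_atTop_atTop (R := ℝ))
        refine h.congr' ?_
        filter_upwards [eventually_ge_atTop 1] with n hn
        have : (0 : ℝ) < n := by exact_mod_cast hn
        rw [Function.comp_apply, ← Real.rpow_sub this]
        congr 1
        ring
    have h2 : (fun n : ℕ => (n : ℝ) ^ a) =O[atTop] remainderOrder g := by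
      refine IsBigO.of_bound 1 (Eventually.of_forall fun n => ?_)
      have h0 : 0 ≤ (n : ℝ) ^ a := by positivity
      rw [one_mul, Real.norm_of_nonneg h0]
      exact (hle n).trans (le_abs_self _)
    have h3 : remainderOrder (2 / 3) = fun n : ℕ => 2 * (n : ℝ) ^ (-(2 / 3) : ℝ) := by
      funext n
      rw [remainderOrder, show (-1 + 2 / 3 / 2 : ℝ) = -(2 / 3) by norm_num]
      ring
    rw [h3]
    exact (h1.const_mul_left 2).trans_isBigO h2
  rcases lt_or_gt_of_ne hg with h | h
  · refine key (-g) (by linarith) fun n => ?_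
    have : 0 ≤ (n : ℝ) ^ (-1 + g / 2) := by positivity
    simp only [remainderOrder]
    linarith
  · refine key (-1 + g / 2) (by linarith) fun n => ?_
    have : 0 ≤ (n : ℝ) ^ (-g) := by positivity
    simp only [remainderOrder]
    linarith

end AISGD

namespace AISGD

variable {p : ℕ} {Y : Type*}

/-! ### The loss at a single data point -/

/-- The properties of a data point `ξ` which the assumptions grant almost surely: on `Θ` the loss
is twice differentiable and Lipschitz, its Hessian is Lipschitz with positive trace. -/
structure IsRegularDatum (Θ : Set (Param p)) (f : ℝ → Y → ℝ) (lam0 lam2 : ℝ)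
    (ξ : Param p × Y) : Prop where
  diff : ∀ θ ∈ Θ, DifferentiableAt ℝ (fun t => loss f t ξ) θ
  diff_grad : ∀ θ ∈ Θ, DifferentiableAt ℝ (gradient fun t => loss f t ξ) θ
  lip : ∀ θ₁ ∈ Θ, ∀ θ₂ ∈ Θ, |loss f θ₁ ξ - loss f θ₂ ξ| ≤ lam0 * ‖θ₁ - θ₂‖
  lip_hess : ∀ θ₁ ∈ Θ, ∀ θ₂ ∈ Θ,
    ‖hessianOp (fun t => loss f t ξ) θ₁ - hessianOp (fun t => loss f t ξ) θ₂‖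
      ≤ lam2 * ‖θ₁ - θ₂‖
  trace_pos : ∀ θ ∈ Θ, 0 < (hessianMat (fun t => loss f t ξ) θ).trace

/-- A point of the segment from an interior point of a convex set to any point of the set. -/
lemma segment_point_mem {Θ : Set (Param p)} (hΘ : Convex ℝ Θ) {θ₀ θ : Param p}
    (h0 : θ₀ ∈ Θ) (h : θ ∈ Θ) {t : ℝ} (ht : t ∈ Set.Icc (0 : ℝ) 1) :
    θ₀ + t • (θ - θ₀) ∈ Θ := by
  have := hΘ h0 h (sub_nonneg.2 ht.2) ht.1 (by ring)
  convert this using 1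
  module

lemma segment_point_mem_interior {Θ : Set (Param p)} (hΘ : Convex ℝ Θ) {θ₀ θ : Param p}
    (h0 : θ₀ ∈ interior Θ) (h : θ ∈ Θ) {t : ℝ} (ht : t ∈ Set.Ico (0 : ℝ) 1) :
    θ₀ + t • (θ - θ₀) ∈ interior Θ := by
  have := hΘ.combo_interior_self_mem_interior h0 h (sub_pos.2 ht.2) ht.1 (by ring)
  convert this using 1
  module

lemma hasDerivAt_add_smul {E : Type*} [NormedAddCommGroup E] [NormedSpace ℝ E]
    {g : Param p → E} {g' : Param p →L[ℝ] E} {θ : Param p} (h : HasFDerivAt g g' θ)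
    (v : Param p) : HasDerivAt (fun t : ℝ => g (θ + t • v)) (g' v) 0 := by
  have hl : HasDerivAt (fun s : ℝ => θ + s • v) v 0 := by
    simpa using ((hasDerivAt_id (0 : ℝ)).smul_const v).const_add θ
  have h' : HasFDerivAt g g' (θ + (0 : ℝ) • v) := by simpa using h
  exact h'.comp_hasDerivAt 0 hl

/-- If the gradient is differentiable, the Hessian of a loss with linear predictor is a multiple
of the rank one operator `x xᵀ`. -/
lemma exists_hessianOp_loss_eq (f : ℝ → Y → ℝ) (ξ : Param p × Y) {θ : Param p}
    (hd : DifferentiableAt ℝ (gradient fun t => loss f t ξ) θ) :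
    ∃ c : ℝ, ∀ v : Param p,
      hessianOp (fun t => loss f t ξ) θ v = (c * inner ℝ ξ.1 v) • ξ.1 := by
  obtain ⟨x, y⟩ := ξ
  -- the gradient is `h(xᵀθ) x` at every point, also where the loss is not differentiable
  by_cases hx : x = 0
  · subst hx
    refine ⟨0, fun v => ?_⟩
    have : (fun t : Param p => loss f t ((0 : Param p), y)) = fun _ => f 0 y := by
      funext t
      simp [loss]
    have hg : gradient (fun t : Param p => loss f t ((0 : Param p), y)) = fun _ => 0 := by
      rw [this]
      funext t
      simp
    simp [hessianOp, hg]
  have hxx : ‖x‖ ^ 2 ≠ 0 := by positivity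
  have hgrad : ∀ t : Param p, gradient (fun t => loss f t (x, y)) t
      = deriv (fun s => f s y) (inner ℝ x t) • x := by
    intro t
    by_cases hdf : DifferentiableAt ℝ (fun s => f s y) (inner ℝ x t)
    · apply HasGradientAt.gradient
      rw [hasGradientAt_iff_hasFDerivAt]
      have h1 : HasFDerivAt (fun t : Param p => inner ℝ x t) (innerSL ℝ x) t :=
        (innerSL ℝ x).hasFDerivAt
      have h2 := hdf.hasDerivAt.comp_hasFDerivAt t h1
      refine h2.congr_fderiv ?_
      ext v
      simp
    · rw [deriv_zero_of_not_differentiableAt hdf, zero_smul]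
      apply gradient_eq_zero_of_not_differentiableAt
      intro hL
      apply hdf
      have hline : DifferentiableAt ℝ
          (fun s : ℝ => t + ((s - inner ℝ x t) / ‖x‖ ^ 2) • x) (inner ℝ x t) := by fun_prop
      have hcomp : DifferentiableAt ℝ (fun s : ℝ => loss f
          (t + ((s - inner ℝ x t) / ‖x‖ ^ 2) • x) (x, y)) (inner ℝ x t) := by
        apply DifferentiableAt.comp (inner ℝ x t) (g := fun t => loss f t (x, y)) _ hline
        simpa using hL
      convert hcomp using 2 with s
      simp only [loss, inner_add_right, inner_smul_right, real_inner_self_eq_norm_sq]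
      congr 1
      field_simp
      ring
  refine ⟨inner ℝ x (hessianOp (fun t => loss f t (x, y)) θ x) / ‖x‖ ^ 2 / ‖x‖ ^ 2, fun v => ?_⟩
  set A := hessianOp (fun t => loss f t (x, y)) θ with hA
  have hAd : HasFDerivAt (gradient fun t => loss f t (x, y)) A θ := hd.hasFDerivAt
  -- directional derivative of the gradient along `v`
  have hdir : ∀ v : Param p, HasDerivAt
      (fun s : ℝ => gradient (fun t => loss f t (x, y)) (θ + s • v)) (A v) 0 :=
    hasDerivAt_add_smul hAd
  have hort : ∀ v : Param p, inner ℝ x v = 0 → A v = 0 := by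
    intro v hv
    have h1 := hdir v
    have h2 : (fun s : ℝ => gradient (fun t => loss f t (x, y)) (θ + s • v))
        = fun _ => gradient (fun t => loss f t (x, y)) θ := by
      funext s
      simp [hgrad, inner_add_right, inner_smul_right, hv]
    rw [h2] at h1
    exact h1.unique (hasDerivAt_const _ _)
  have hAx : A x = (inner ℝ x (A x) / ‖x‖ ^ 2) • x := by
    -- the range of the derivative lies in the line spanned by `x`
    have h1 := hdir x
    set π : Param p →L[ℝ] Param p :=
      ContinuousLinearMap.id ℝ (Param p) - (‖x‖ ^ 2)⁻¹ • (innerSL ℝ x).smulRight x with hπ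
    have h2 := (π.hasFDerivAt (x := gradient (fun t => loss f t (x, y))
      (θ + (0 : ℝ) • x))).comp_hasDerivAt (0 : ℝ) h1
    have h3 : (π ∘ fun s : ℝ => gradient (fun t => loss f t (x, y)) (θ + s • x))
        = fun _ => 0 := by
      funext s
      simp only [Function.comp_apply, hgrad, hπ, map_smul]
      have : ((ContinuousLinearMap.id ℝ (Param p)
          - (‖x‖ ^ 2)⁻¹ • (innerSL ℝ x).smulRight x) x) = 0 := by
        simp [smul_smul, hxx]
      rw [this, smul_zero]
    rw [h3] at h2
    have h4 := h2.unique (hasDerivAt_const _ _)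
    simp only [hπ, sub_apply, ContinuousLinearMap.id_apply,
      smul_apply, ContinuousLinearMap.smulRight_apply, innerSL_apply_apply,
      smul_smul] at h4
    rw [sub_eq_zero] at h4
    rw [div_eq_inv_mul]
    exact h4
  have hv : v = (inner ℝ x v / ‖x‖ ^ 2) • x + (v - (inner ℝ x v / ‖x‖ ^ 2) • x) := by abel
  have h0 : A (v - (inner ℝ x v / ‖x‖ ^ 2) • x) = 0 := by
    apply hort
    rw [inner_sub_right, inner_smul_right, real_inner_self_eq_norm_sq]
    field_simp
    ring
  calc A v = (inner ℝ x v / ‖x‖ ^ 2) • A x := by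
        conv_lhs => rw [hv]
        rw [map_add, map_smul, h0, add_zero]
    _ = _ := by
        conv_lhs => rw [hAx]
        rw [smul_smul]
        congr 1
        ring

lemma trace_hessianMat (g : Param p → ℝ) (θ : Param p) {c : ℝ} {x : Param p}
    (h : ∀ v, hessianOp g θ v = (c * inner ℝ x v) • x) :
    (hessianMat g θ).trace = c * ‖x‖ ^ 2 := by
  simp only [Matrix.trace, Matrix.diag_apply, hessianMat, Matrix.of_apply, h, PiLp.smul_apply,
    smul_eq_mul, EuclideanSpace.inner_single_right, EuclideanSpace.norm_sq_eq]
  rw [Finset.mul_sum]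
  refine Finset.sum_congr rfl fun i _ => ?_
  simp
  ring

namespace IsRegularDatum

variable {Θ : Set (Param p)} {f : ℝ → Y → ℝ} {lam0 lam2 : ℝ} {ξ : Param p × Y}

lemma hasFDerivAt_grad (h : IsRegularDatum Θ f lam0 lam2 ξ) {θ : Param p} (hθ : θ ∈ Θ) :
    HasFDerivAt (fun t => lossGrad f t ξ) (hessianOp (fun t => loss f t ξ) θ) θ :=
  (h.diff_grad θ hθ).hasFDerivAt

lemma inner_hessianOp_comm (h : IsRegularDatum Θ f lam0 lam2 ξ) {θ : Param p} (hθ : θ ∈ Θ)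
    (u v : Param p) : inner ℝ u (hessianOp (fun t => loss f t ξ) θ v)
      = inner ℝ v (hessianOp (fun t => loss f t ξ) θ u) := by
  obtain ⟨c, hc⟩ := exists_hessianOp_loss_eq f ξ (h.diff_grad θ hθ)
  simp only [hc, inner_smul_right, real_inner_comm ξ.1]
  ring

/-- The Hessian of the loss is positive semidefinite: it has rank one and positive trace. -/
lemma inner_hessianOp_nonneg (h : IsRegularDatum Θ f lam0 lam2 ξ) {θ : Param p} (hθ : θ ∈ Θ)
    (v : Param p) : 0 ≤ inner ℝ v (hessianOp (fun t => loss f t ξ) θ v) := by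
  obtain ⟨c, hc⟩ := exists_hessianOp_loss_eq f ξ (h.diff_grad θ hθ)
  have ht := h.trace_pos θ hθ
  rw [trace_hessianMat _ _ hc] at ht
  have hc0 : 0 < c := pos_of_mul_pos_left ht (by positivity)
  rw [hc, inner_smul_right, real_inner_comm, mul_assoc]
  exact mul_nonneg hc0.le (mul_self_nonneg _)

/-- The gradient of the loss is bounded on `Θ`, boundary points included. -/
lemma norm_lossGrad_le (h : IsRegularDatum Θ f lam0 lam2 ξ) (hΘ : Convex ℝ Θ) {θ₀ : Param p}
    (h0 : θ₀ ∈ interior Θ) {θ : Param p} (hθ : θ ∈ Θ) : ‖lossGrad f θ ξ‖ ≤ |lam0| := by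
  have hint : ∀ θ ∈ interior Θ, ‖lossGrad f θ ξ‖ ≤ |lam0| := by
    intro θ hθ
    have h1 : ‖lossGrad f θ ξ‖ = ‖fderiv ℝ (fun t => loss f t ξ) θ‖ := by
      simp [lossGrad, gradient]
    rw [h1]
    apply norm_fderiv_le_of_lip' ℝ (abs_nonneg _)
    filter_upwards [mem_interior_iff_mem_nhds.1 hθ] with t ht
    rw [Real.norm_eq_abs]
    refine (h.lip t ht θ (interior_subset hθ)).trans ?_
    gcongr
    exact le_abs_self _
  -- a boundary point is approached along the segment from an interior point
  have hc : Tendsto (fun t : ℝ => ‖lossGrad f (θ₀ + t • (θ - θ₀)) ξ‖) (𝓝[<] 1)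
      (𝓝 ‖lossGrad f θ ξ‖) := by
    have h2 : ContinuousAt (fun t => lossGrad f t ξ) (θ₀ + (1 : ℝ) • (θ - θ₀)) := by
      simpa using (h.hasFDerivAt_grad hθ).continuousAt
    have h3 : ContinuousAt (fun t : ℝ => lossGrad f (θ₀ + t • (θ - θ₀)) ξ) 1 :=
      ContinuousAt.comp (f := fun t : ℝ => θ₀ + t • (θ - θ₀)) h2 (by fun_prop)
    have h4 := h3.norm.tendsto.mono_left (nhdsWithin_le_nhds (s := Set.Iio 1))
    simpa using h4
  refine le_of_tendsto hc ?_
  filter_upwards [Ico_mem_nhdsLT (zero_lt_one (α := ℝ))] with t ht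
  exact hint _ (segment_point_mem_interior hΘ h0 hθ ht)

/-- Taylor's formula of order one for the gradient. -/
lemma norm_lossGrad_sub_sub_le (h : IsRegularDatum Θ f lam0 lam2 ξ) (hΘ : Convex ℝ Θ)
    {θ₀ θ : Param p} (h0 : θ₀ ∈ Θ) (hθ : θ ∈ Θ) :
    ‖lossGrad f θ ξ - lossGrad f θ₀ ξ - hessianOp (fun t => loss f t ξ) θ₀ (θ - θ₀)‖
      ≤ |lam2| * ‖θ - θ₀‖ ^ 2 := by
  set M := hessianOp (fun t => loss f t ξ) θ₀
  have hseg : segment ℝ θ₀ θ ⊆ Θ := hΘ.segment_subset h0 hθ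
  have := Convex.norm_image_sub_le_of_norm_hasFDerivWithin_le (𝕜 := ℝ)
    (f := fun t => lossGrad f t ξ - M t) (s := segment ℝ θ₀ θ)
    (f' := fun t => hessianOp (fun t => loss f t ξ) t - M) (C := |lam2| * ‖θ - θ₀‖)
    (fun t ht => ((h.hasFDerivAt_grad (hseg ht)).sub M.hasFDerivAt).hasFDerivWithinAt)
    (fun t ht => ?_) (convex_segment _ _) (left_mem_segment ℝ θ₀ θ) (right_mem_segment ℝ θ₀ θ)
  · rw [map_sub, sq, ← mul_assoc, sub_sub_sub_comm]
    exact this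
  · refine (h.lip_hess t (hseg ht) θ₀ h0).trans ?_
    have h1 : ‖t - θ₀‖ ≤ ‖θ - θ₀‖ := by
      obtain ⟨s, hs, rfl⟩ := (segment_eq_image' ℝ θ₀ θ ▸ ht : t ∈ _ '' _)
      rw [add_sub_cancel_left, norm_smul, Real.norm_of_nonneg hs.1]
      exact mul_le_of_le_one_left (norm_nonneg _) hs.2
    calc lam2 * ‖t - θ₀‖ ≤ |lam2| * ‖t - θ₀‖ := by gcongr; exact le_abs_self _
      _ ≤ _ := by gcongr

/-- The Hessian of the loss is bounded near an interior point: a bounded function with Lipschitz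
derivative has a bounded derivative. -/
lemma norm_hessianOp_le (h : IsRegularDatum Θ f lam0 lam2 ξ) (hΘ : Convex ℝ Θ)
    {θ₀ : Param p} {r : ℝ} (hr : 0 < r) (hball : Metric.closedBall θ₀ r ⊆ Θ) :
    ‖hessianOp (fun t => loss f t ξ) θ₀‖ ≤ (2 * |lam0| + |lam2| * r ^ 2) / r := by
  have h0 : θ₀ ∈ Θ := hball (Metric.mem_closedBall_self hr.le)
  have h0' : θ₀ ∈ interior Θ :=
    interior_mono hball (interior_mono Metric.ball_subset_closedBall
      (by rw [Metric.isOpen_ball.interior_eq]; exact Metric.mem_ball_self hr))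
  refine ContinuousLinearMap.opNorm_le_of_unit_norm (by positivity) fun u hu => ?_
  have hmem : θ₀ + r • u ∈ Θ := hball (by simp [norm_smul, hu, abs_of_pos hr])
  have h1 := h.norm_lossGrad_sub_sub_le hΘ h0 hmem
  rw [add_sub_cancel_left, norm_smul, hu, mul_one, Real.norm_of_nonneg hr.le, map_smul] at h1
  have h2 := h.norm_lossGrad_le hΘ h0' hmem
  have h3 := h.norm_lossGrad_le hΘ h0' h0
  have h4 : ‖r • hessianOp (fun t => loss f t ξ) θ₀ u‖ ≤ 2 * |lam0| + |lam2| * r ^ 2 := by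
    have e : r • hessianOp (fun t => loss f t ξ) θ₀ u
        = lossGrad f (θ₀ + r • u) ξ - lossGrad f θ₀ ξ - (lossGrad f (θ₀ + r • u) ξ
          - lossGrad f θ₀ ξ - r • hessianOp (fun t => loss f t ξ) θ₀ u) := by abel
    rw [e]
    refine (norm_sub_le _ _).trans ?_
    have := norm_sub_le (lossGrad f (θ₀ + r • u) ξ) (lossGrad f θ₀ ξ)
    linarith
  rw [norm_smul, Real.norm_of_nonneg hr.le] at h4
  rw [le_div_iff₀ hr, mul_comm]
  exact h4

/-- The loss is convex, in the form of the subgradient inequality. -/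
lemma loss_sub_le_inner (h : IsRegularDatum Θ f lam0 lam2 ξ) (hΘ : Convex ℝ Θ)
    {θ₀ θ : Param p} (h0 : θ₀ ∈ Θ) (hθ : θ ∈ Θ) :
    loss f θ ξ - loss f θ₀ ξ ≤ inner ℝ (lossGrad f θ ξ) (θ - θ₀) := by
  set d := θ - θ₀ with hd
  have hmem : ∀ t ∈ Set.Icc (0 : ℝ) 1, θ₀ + t • d ∈ Θ := fun t ht => segment_point_mem hΘ h0 hθ ht
  have hline : ∀ t : ℝ, HasDerivAt (fun s : ℝ => θ₀ + s • d) d t := fun t => by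
    simpa using ((hasDerivAt_id t).smul_const d).const_add θ₀
  have hd1 : ∀ t ∈ Set.Icc (0 : ℝ) 1, HasDerivAt (fun s : ℝ => loss f (θ₀ + s • d) ξ)
      (inner ℝ (lossGrad f (θ₀ + t • d) ξ) d) t := by
    intro t ht
    have h1 := (h.diff _ (hmem t ht)).hasGradientAt.hasFDerivAt.comp_hasDerivAt t (hline t)
    rw [InnerProductSpace.toDual_apply_apply] at h1
    exact h1
  have hd2 : ∀ t ∈ Set.Icc (0 : ℝ) 1,
      HasDerivAt (fun s : ℝ => inner ℝ (lossGrad f (θ₀ + s • d) ξ) d)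
      (inner ℝ (hessianOp (fun t => loss f t ξ) (θ₀ + t • d) d) d) t := by
    intro t ht
    have h1 := (h.hasFDerivAt_grad (hmem t ht)).comp_hasDerivAt t (hline t)
    simpa using h1.inner ℝ (hasDerivAt_const t d)
  have hmono : MonotoneOn (fun s : ℝ => inner ℝ (lossGrad f (θ₀ + s • d) ξ) d)
      (Set.Icc (0 : ℝ) 1) := by
    refine monotoneOn_of_deriv_nonneg (convex_Icc 0 1)
      (fun t ht => (hd2 t ht).continuousAt.continuousWithinAt)
      (fun t ht => (hd2 t (interior_subset ht)).differentiableAt.differentiableWithinAt)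
      (fun t ht => ?_)
    rw [(hd2 t (interior_subset ht)).deriv, real_inner_comm]
    exact h.inner_hessianOp_nonneg (hmem t (interior_subset ht)) d
  have hmv := Convex.image_sub_le_mul_sub_of_deriv_le (convex_Icc (0 : ℝ) 1)
    (f := fun s : ℝ => loss f (θ₀ + s • d) ξ) (C := inner ℝ (lossGrad f θ ξ) d)
    (fun t ht => (hd1 t ht).continuousAt.continuousWithinAt)
    (fun t ht => (hd1 t (interior_subset ht)).differentiableAt.differentiableWithinAt)
    (fun t ht => ?_) 0 (by simp) 1 (by simp) zero_le_one
  · simpa [hd] using hmv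
  · rw [(hd1 t (interior_subset ht)).deriv]
    have := hmono (interior_subset ht) (by simp : (1 : ℝ) ∈ Set.Icc (0 : ℝ) 1)
      (interior_subset ht).2
    simpa [hd] using this

end IsRegularDatum

end AISGD

namespace AISGD

variable {p : ℕ} {Y : Type*} [MeasurableSpace Y]

/-! ### The expected loss -/

/-- A vector valued function is measurable as soon as its inner products are. -/
lemma aestronglyMeasurable_of_inner {α : Type*} [MeasurableSpace α] {μ : Measure α}
    {g : α → Param p} (h : ∀ v : Param p, AEStronglyMeasurable (fun a => inner ℝ v (g a)) μ) :
    AEStronglyMeasurable g μ := by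
  have e : g = fun a => ∑ i, inner ℝ (EuclideanSpace.basisFun (Fin p) ℝ i) (g a) •
      EuclideanSpace.basisFun (Fin p) ℝ i := by
    funext a
    exact ((EuclideanSpace.basisFun (Fin p) ℝ).sum_repr' (g a)).symm
  rw [e]
  exact Finset.aestronglyMeasurable_fun_sum _ fun i _ => (h _).smul_const _

/-- An operator valued function is measurable as soon as its values on vectors are. -/
lemma aestronglyMeasurable_of_apply {α : Type*} [MeasurableSpace α] {μ : Measure α}
    {M : α → Param p →L[ℝ] Param p}
    (h : ∀ v : Param p, AEStronglyMeasurable (fun a => M a v) μ) :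
    AEStronglyMeasurable M μ := by
  have e : M = fun a => ∑ i, ContinuousLinearMap.smulRightL ℝ (Param p) (Param p)
      (innerSL ℝ (EuclideanSpace.basisFun (Fin p) ℝ i))
        (M a (EuclideanSpace.basisFun (Fin p) ℝ i)) := by
    funext a
    ext1 v
    conv_lhs => rw [← (EuclideanSpace.basisFun (Fin p) ℝ).sum_repr' v]
    simp [map_sum]
  rw [e]
  exact Finset.aestronglyMeasurable_fun_sum _ fun i _ =>
    (ContinuousLinearMap.continuous _).comp_aestronglyMeasurable (h _)

/-- A derivative which exists almost everywhere is measurable. -/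
lemma aestronglyMeasurable_of_hasDerivAt {α E : Type*} [MeasurableSpace α] {μ : Measure α}
    [NormedAddCommGroup E] [NormedSpace ℝ E] {F : ℝ → α → E} {F' : α → E} {δ : ℝ} (hδ : 0 < δ)
    (hF : ∀ t ∈ Set.Icc 0 δ, AEStronglyMeasurable (F t) μ)
    (hd : ∀ᵐ a ∂μ, HasDerivAt (fun t => F t a) (F' a) 0) : AEStronglyMeasurable F' μ := by
  have hpos : ∀ k : ℕ, 0 < δ * (1 / ((k : ℝ) + 1)) := fun k => by positivity
  have ht : Tendsto (fun k : ℕ => δ * (1 / ((k : ℝ) + 1))) atTop (𝓝[≠] 0) := by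
    refine tendsto_nhdsWithin_iff.2 ⟨?_, Eventually.of_forall fun k => (hpos k).ne'⟩
    simpa using tendsto_one_div_add_atTop_nhds_zero_nat.const_mul δ
  refine aestronglyMeasurable_of_tendsto_ae atTop
    (f := fun (k : ℕ) a => (δ * (1 / ((k : ℝ) + 1)))⁻¹ • (F (δ * (1 / ((k : ℝ) + 1))) a - F 0 a))
    (fun k => ?_) ?_
  · refine ((hF _ ⟨(hpos k).le, ?_⟩).sub (hF 0 ⟨le_rfl, hδ.le⟩)).const_smul _
    apply mul_le_of_le_one_right hδ.le
    rw [div_le_one (by positivity)]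
    linarith [k.cast_nonneg (α := ℝ)]
  · filter_upwards [hd] with a ha
    have := ha.tendsto_slope_zero.comp ht
    simp only [zero_add] at this
    exact this

lemma measurable_loss_uncurry {f : ℝ → Y → ℝ} (hf : Measurable (Function.uncurry f)) :
    Measurable fun z : Param p × (Param p × Y) => loss f z.1 z.2 := by
  have h : Measurable fun z : Param p × (Param p × Y) => (inner ℝ z.2.1 z.1, z.2.2) := by
    fun_prop
  exact hf.comp h

lemma measurable_loss_apply {f : ℝ → Y → ℝ} (hf : Measurable (Function.uncurry f)) (θ : Param p) :
    Measurable (loss f θ) :=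
  (measurable_loss_uncurry hf).comp measurable_prodMk_left

lemma exists_add_smul_mem {Θ : Set (Param p)} {θ : Param p} (hθ : θ ∈ interior Θ)
    (v : Param p) : ∃ δ : ℝ, 0 < δ ∧ ∀ t ∈ Set.Icc 0 δ, θ + t • v ∈ interior Θ := by
  have hc : ContinuousAt (fun t : ℝ => θ + t • v) 0 := by fun_prop
  have := hc.preimage_mem_nhds (t := interior Θ)
    (by simpa using isOpen_interior.mem_nhds hθ)
  obtain ⟨δ, hδ, hsub⟩ := Metric.nhds_basis_closedBall.mem_iff.1 this
  refine ⟨δ, hδ, fun t ht => hsub ?_⟩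
  rw [Metric.mem_closedBall, dist_zero_right, Real.norm_of_nonneg ht.1]
  exact ht.2

namespace Assumptions

variable {Θ : Set (Param p)} {f : ℝ → Y → ℝ} {P : Measure (Param p × Y)}
  {θs : Param p} {S : Matrix (Fin p) (Fin p) ℝ} {lam0 lam2 lamf φ : ℝ}

lemma target_mem (hA : Assumptions Θ f P θs S lam0 lam2 lamf φ) : θs ∈ Θ :=
  interior_subset hA.target_interior

lemma ae_isRegularDatum (hA : Assumptions Θ f P θs S lam0 lam2 lamf φ) :
    ∀ᵐ ξ ∂P, IsRegularDatum Θ f lam0 lam2 ξ := by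
  filter_upwards [hA.differentiable, hA.twice_differentiable, hA.lipschitz_loss,
    hA.lipschitz_hessian, hA.trace_lower] with ξ h1 h2 h3 h4 h5
  exact ⟨h1, h2, h3, h4, fun θ hθ => (hA.lamf_pos.trans_le hA.lamf_le).trans_le (h5 θ hθ)⟩

lemma aestronglyMeasurable_lossGrad (hA : Assumptions Θ f P θs S lam0 lam2 lamf φ)
    {θ : Param p} (hθ : θ ∈ Θ) : AEStronglyMeasurable (lossGrad f θ) P := by
  refine aestronglyMeasurable_of_inner fun v => ?_
  refine aestronglyMeasurable_of_hasDerivAt (F := fun t ξ => loss f (θ + t • v) ξ) zero_lt_one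
    (fun t _ => (measurable_loss_apply hA.measurable_loss _).aestronglyMeasurable) ?_
  filter_upwards [hA.ae_isRegularDatum] with ξ hξ
  have := hasDerivAt_add_smul (hξ.diff θ hθ).hasGradientAt.hasFDerivAt v
  rw [InnerProductSpace.toDual_apply_apply, real_inner_comm] at this
  exact this

lemma aestronglyMeasurable_hessianOp (hA : Assumptions Θ f P θs S lam0 lam2 lamf φ)
    {θ : Param p} (hθ : θ ∈ interior Θ) :
    AEStronglyMeasurable (fun ξ => hessianOp (fun t => loss f t ξ) θ) P := by
  refine aestronglyMeasurable_of_apply fun v => ?_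
  obtain ⟨δ, hδ, hmem⟩ := exists_add_smul_mem hθ v
  refine aestronglyMeasurable_of_hasDerivAt (F := fun t ξ => lossGrad f (θ + t • v) ξ) hδ
    (fun t ht => hA.aestronglyMeasurable_lossGrad (interior_subset (hmem t ht))) ?_
  filter_upwards [hA.ae_isRegularDatum] with ξ hξ
  exact hasDerivAt_add_smul (hξ.hasFDerivAt_grad (interior_subset hθ)) v

lemma ae_norm_lossGrad_le (hA : Assumptions Θ f P θs S lam0 lam2 lamf φ)
    {θ : Param p} (hθ : θ ∈ Θ) : ∀ᵐ ξ ∂P, ‖lossGrad f θ ξ‖ ≤ |lam0| := by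
  filter_upwards [hA.ae_isRegularDatum] with ξ hξ
  exact hξ.norm_lossGrad_le hA.convex_space hA.target_interior hθ

lemma integrable_lossGrad [IsProbabilityMeasure P]
    (hA : Assumptions Θ f P θs S lam0 lam2 lamf φ)
    {θ : Param p} (hθ : θ ∈ Θ) : Integrable (lossGrad f θ) P :=
  .of_bound (hA.aestronglyMeasurable_lossGrad hθ) _ (hA.ae_norm_lossGrad_le hθ)

/-- Near an interior point the Hessian of the loss is uniformly bounded. -/
lemma exists_ball_norm_hessianOp_le (hA : Assumptions Θ f P θs S lam0 lam2 lamf φ)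
    {θ : Param p} (hθ : θ ∈ interior Θ) : ∃ r K : ℝ, 0 < r ∧ Metric.closedBall θ r ⊆ Θ ∧ 0 ≤ K ∧
      ∀ ξ, IsRegularDatum Θ f lam0 lam2 ξ → ∀ t ∈ Metric.closedBall θ r,
        ‖hessianOp (fun t => loss f t ξ) t‖ ≤ K := by
  obtain ⟨r, hr, hball⟩ :=
    Metric.nhds_basis_closedBall.mem_iff.1 (mem_interior_iff_mem_nhds.1 hθ)
  refine ⟨r / 2, (2 * |lam0| + |lam2| * (r / 2) ^ 2) / (r / 2), by positivity,
    (Metric.closedBall_subset_closedBall (by linarith)).trans hball, by positivity,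
    fun ξ hξ t ht => ?_⟩
  refine hξ.norm_hessianOp_le hA.convex_space (by positivity) (subset_trans ?_ hball)
  apply Metric.closedBall_subset_closedBall'
  rw [Metric.mem_closedBall] at ht
  linarith

lemma ae_norm_hessianOp_le (hA : Assumptions Θ f P θs S lam0 lam2 lamf φ)
    {θ : Param p} (hθ : θ ∈ interior Θ) :
    ∃ K : ℝ, 0 ≤ K ∧ ∀ᵐ ξ ∂P, ‖hessianOp (fun t => loss f t ξ) θ‖ ≤ K := by
  obtain ⟨r, K, hr, -, hK, hb⟩ := hA.exists_ball_norm_hessianOp_le hθ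
  refine ⟨K, hK, ?_⟩
  filter_upwards [hA.ae_isRegularDatum] with ξ hξ
  exact hb ξ hξ θ (Metric.mem_closedBall_self hr.le)

lemma integrable_hessianOp [IsProbabilityMeasure P]
    (hA : Assumptions Θ f P θs S lam0 lam2 lamf φ)
    {θ : Param p} (hθ : θ ∈ interior Θ) :
    Integrable (fun ξ => hessianOp (fun t => loss f t ξ) θ) P := by
  obtain ⟨K, -, hK⟩ := hA.ae_norm_hessianOp_le hθ
  exact .of_bound (hA.aestronglyMeasurable_hessianOp hθ) K hK

/-- The gradient of the loss is uniformly Lipschitz near an interior point. -/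
lemma exists_lipschitzOnWith_lossGrad (hA : Assumptions Θ f P θs S lam0 lam2 lamf φ)
    {θ : Param p} (hθ : θ ∈ interior Θ) : ∃ r K : ℝ, 0 < r ∧ Metric.closedBall θ r ⊆ Θ ∧ 0 ≤ K ∧
      ∀ ξ, IsRegularDatum Θ f lam0 lam2 ξ →
        ∀ t₁ ∈ Metric.closedBall θ r, ∀ t₂ ∈ Metric.closedBall θ r,
          ‖lossGrad f t₁ ξ - lossGrad f t₂ ξ‖ ≤ K * ‖t₁ - t₂‖ := by
  obtain ⟨r, K, hr, hball, hK, hb⟩ := hA.exists_ball_norm_hessianOp_le hθ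
  refine ⟨r, K, hr, hball, hK, fun ξ hξ t₁ h1 t₂ h2 => ?_⟩
  exact Convex.norm_image_sub_le_of_norm_hasFDerivWithin_le (𝕜 := ℝ)
    (fun t ht => (hξ.hasFDerivAt_grad (hball ht)).hasFDerivWithinAt) (hb ξ hξ)
    (convex_closedBall θ r) h2 h1

lemma hasGradientAt_expectedLoss [IsProbabilityMeasure P]
    (hA : Assumptions Θ f P θs S lam0 lam2 lamf φ) {θ : Param p} (hθ : θ ∈ interior Θ) :
    HasGradientAt (expectedLoss f P) (∫ ξ, lossGrad f θ ξ ∂P) θ := by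
  have hθ' := interior_subset hθ
  obtain ⟨hi, hd⟩ := hasFDerivAt_integral_of_dominated_loc_of_lip (𝕜 := ℝ) (μ := P)
    (F := fun t ξ => loss f t ξ) (x₀ := θ) (bound := fun _ => |lam0|) (s := Θ)
    (F' := fun ξ => innerSL ℝ (lossGrad f θ ξ)) (mem_interior_iff_mem_nhds.1 hθ)
    (Eventually.of_forall fun t => (measurable_loss_apply hA.measurable_loss t).aestronglyMeasurable)
    (hA.integrable_loss θ hθ')
    ((innerSL ℝ).continuous.comp_aestronglyMeasurable (hA.aestronglyMeasurable_lossGrad hθ'))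
    (by
      filter_upwards [hA.ae_isRegularDatum] with ξ hξ
      refine LipschitzOnWith.of_dist_le_mul fun t₁ h1 t₂ h2 => ?_
      rw [Real.dist_eq, dist_eq_norm, Real.coe_nnabs, abs_abs]
      refine (hξ.lip t₁ h1 t₂ h2).trans ?_
      gcongr
      exact le_abs_self _)
    (integrable_const _)
    (by
      filter_upwards [hA.ae_isRegularDatum] with ξ hξ
      exact (hξ.diff θ hθ').hasGradientAt.hasFDerivAt)
  rw [hasGradientAt_iff_hasFDerivAt]
  refine HasFDerivAt.congr_fderiv (f := expectedLoss f P) hd ?_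
  ext1 v
  rw [ContinuousLinearMap.integral_apply hi, InnerProductSpace.toDual_apply_apply,
    real_inner_comm, ← integral_inner (hA.integrable_lossGrad hθ')]
  simp [real_inner_comm]

lemma gradient_expectedLoss [IsProbabilityMeasure P]
    (hA : Assumptions Θ f P θs S lam0 lam2 lamf φ) {θ : Param p} (hθ : θ ∈ interior Θ) :
    gradient (expectedLoss f P) θ = ∫ ξ, lossGrad f θ ξ ∂P :=
  (hA.hasGradientAt_expectedLoss hθ).gradient

lemma hasFDerivAt_gradient_expectedLoss [IsProbabilityMeasure P]
    (hA : Assumptions Θ f P θs S lam0 lam2 lamf φ) {θ : Param p} (hθ : θ ∈ interior Θ) :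
    HasFDerivAt (gradient (expectedLoss f P)) (∫ ξ, hessianOp (fun t => loss f t ξ) θ ∂P) θ := by
  have hθ' := interior_subset hθ
  obtain ⟨r, K, hr, hball, hK, hlip⟩ := hA.exists_lipschitzOnWith_lossGrad hθ
  have hd := (hasFDerivAt_integral_of_dominated_loc_of_lip (𝕜 := ℝ) (μ := P)
    (F := fun t ξ => lossGrad f t ξ) (x₀ := θ) (bound := fun _ => K)
    (s := Metric.closedBall θ r)
    (F' := fun ξ => hessianOp (fun t => loss f t ξ) θ) (Metric.closedBall_mem_nhds θ hr)
    (by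
      filter_upwards [Metric.closedBall_mem_nhds θ hr] with t ht
      exact hA.aestronglyMeasurable_lossGrad (hball ht))
    (hA.integrable_lossGrad hθ') (hA.aestronglyMeasurable_hessianOp hθ)
    (by
      filter_upwards [hA.ae_isRegularDatum] with ξ hξ
      refine LipschitzOnWith.of_dist_le_mul fun t₁ h1 t₂ h2 => ?_
      rw [dist_eq_norm, dist_eq_norm, Real.coe_nnabs, abs_of_nonneg hK]
      exact hlip ξ hξ t₁ h1 t₂ h2)
    (integrable_const _)
    (by
      filter_upwards [hA.ae_isRegularDatum] with ξ hξ
      exact hξ.hasFDerivAt_grad hθ')).2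
  refine hd.congr_of_eventuallyEq ?_
  filter_upwards [isOpen_interior.mem_nhds hθ] with t ht
  exact hA.gradient_expectedLoss ht

lemma hessianOp_expectedLoss [IsProbabilityMeasure P]
    (hA : Assumptions Θ f P θs S lam0 lam2 lamf φ) {θ : Param p} (hθ : θ ∈ interior Θ) :
    hessianOp (expectedLoss f P) θ = ∫ ξ, hessianOp (fun t => loss f t ξ) θ ∂P :=
  (hA.hasFDerivAt_gradient_expectedLoss hθ).fderiv

lemma gradient_expectedLoss_target [IsProbabilityMeasure P]
    (hA : Assumptions Θ f P θs S lam0 lam2 lamf φ) : gradient (expectedLoss f P) θs = 0 := by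
  have h : IsLocalMin (expectedLoss f P) θs :=
    hA.target_min.isLocalMin (mem_interior_iff_mem_nhds.1 hA.target_interior)
  simp [gradient, h.fderiv_eq_zero]

lemma integral_lossGrad_target [IsProbabilityMeasure P]
    (hA : Assumptions Θ f P θs S lam0 lam2 lamf φ) : ∫ ξ, lossGrad f θs ξ ∂P = 0 := by
  rw [← hA.gradient_expectedLoss hA.target_interior, hA.gradient_expectedLoss_target]

lemma gradNoise_target [IsProbabilityMeasure P]
    (hA : Assumptions Θ f P θs S lam0 lam2 lamf φ) : gradNoise f P θs = lossGrad f θs := by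
  funext ξ
  simp [gradNoise, hA.gradient_expectedLoss_target]

lemma le_inner_hessianOp [IsProbabilityMeasure P]
    (hA : Assumptions Θ f P θs S lam0 lam2 lamf φ) {θ : Param p} (hθ : θ ∈ interior Θ)
    (v : Param p) : lamf * ‖v‖ ^ 2 ≤ inner ℝ v (hessianOp (expectedLoss f P) θ v) := by
  rw [hA.hessianOp_expectedLoss hθ]
  exact hA.fisher_lower θ (interior_subset hθ) v

lemma abs_expectedLoss_sub_le [IsProbabilityMeasure P]
    (hA : Assumptions Θ f P θs S lam0 lam2 lamf φ) {θ₁ θ₂ : Param p} (h1 : θ₁ ∈ Θ)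
    (h2 : θ₂ ∈ Θ) : |expectedLoss f P θ₁ - expectedLoss f P θ₂| ≤ |lam0| * ‖θ₁ - θ₂‖ := by
  rw [expectedLoss, expectedLoss,
    ← integral_sub (hA.integrable_loss θ₁ h1) (hA.integrable_loss θ₂ h2), ← Real.norm_eq_abs]
  have := norm_integral_le_of_norm_le_const (μ := P) (C := |lam0| * ‖θ₁ - θ₂‖)
    (f := fun ξ => loss f θ₁ ξ - loss f θ₂ ξ) (by
      filter_upwards [hA.ae_isRegularDatum] with ξ hξ
      refine (hξ.lip θ₁ h1 θ₂ h2).trans ?_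
      gcongr
      exact le_abs_self _)
  simpa using this

/-- Quadratic growth of the expected loss at its minimizer, on all of `Θ`. -/
lemma expectedLoss_growth [IsProbabilityMeasure P]
    (hA : Assumptions Θ f P θs S lam0 lam2 lamf φ) {θ : Param p} (hθ : θ ∈ Θ) :
    lamf / 2 * ‖θ - θs‖ ^ 2 ≤ expectedLoss f P θ - expectedLoss f P θs := by
  set d := θ - θs with hd
  have hline : ∀ t : ℝ, HasDerivAt (fun s : ℝ => θs + s • d) d t := fun t => by
    simpa using ((hasDerivAt_id t).smul_const d).const_add θs
  have hmem : ∀ t ∈ Set.Ico (0 : ℝ) 1, θs + t • d ∈ interior Θ := fun t ht =>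
    segment_point_mem_interior hA.convex_space hA.target_interior hθ ht
  have hd1 : ∀ t ∈ Set.Ico (0 : ℝ) 1, HasDerivAt (fun s : ℝ => expectedLoss f P (θs + s • d))
      (inner ℝ (gradient (expectedLoss f P) (θs + t • d)) d) t := by
    intro t ht
    have h1 := (hA.hasGradientAt_expectedLoss (hmem t ht)).hasFDerivAt.comp_hasDerivAt t (hline t)
    rw [InnerProductSpace.toDual_apply_apply, ← hA.gradient_expectedLoss (hmem t ht)] at h1
    exact h1
  have hd2 : ∀ t ∈ Set.Ico (0 : ℝ) 1,
      HasDerivAt (fun s : ℝ => inner ℝ (gradient (expectedLoss f P) (θs + s • d)) d)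
      (inner ℝ (hessianOp (expectedLoss f P) (θs + t • d) d) d) t := by
    intro t ht
    have h1 := (hA.hasFDerivAt_gradient_expectedLoss (hmem t ht)).comp_hasDerivAt t (hline t)
    rw [← hA.hessianOp_expectedLoss (hmem t ht)] at h1
    simpa using h1.inner ℝ (hasDerivAt_const t d)
  -- the slope along the segment grows at least linearly
  have hslope : ∀ t ∈ Set.Ico (0 : ℝ) 1,
      lamf * ‖d‖ ^ 2 * t ≤ inner ℝ (gradient (expectedLoss f P) (θs + t • d)) d := by
    intro t ht
    have h1 := Convex.mul_sub_le_image_sub_of_le_deriv (convex_Ico (0 : ℝ) 1)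
      (f := fun s : ℝ => inner ℝ (gradient (expectedLoss f P) (θs + s • d)) d)
      (C := lamf * ‖d‖ ^ 2)
      (fun t ht => (hd2 t ht).continuousAt.continuousWithinAt)
      (fun t ht => (hd2 t (interior_subset ht)).differentiableAt.differentiableWithinAt)
      (fun t ht => by
        rw [(hd2 t (interior_subset ht)).deriv, real_inner_comm]
        exact hA.le_inner_hessianOp (hmem t (interior_subset ht)) d)
      0 (by simp) t ht ht.1
    simpa [hA.gradient_expectedLoss_target] using h1
  have hcont : ContinuousOn (fun s : ℝ => expectedLoss f P (θs + s • d)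
      - lamf / 2 * ‖d‖ ^ 2 * s ^ 2) (Set.Icc 0 1) := by
    refine ContinuousOn.sub ?_ (by fun_prop)
    have hlip : LipschitzOnWith (Real.nnabs (|lam0| * ‖d‖))
        (fun s : ℝ => expectedLoss f P (θs + s • d)) (Set.Icc 0 1) := by
      refine LipschitzOnWith.of_dist_le_mul fun s hs t ht => ?_
      have h1 := hA.abs_expectedLoss_sub_le
        (segment_point_mem hA.convex_space hA.target_mem hθ hs)
        (segment_point_mem hA.convex_space hA.target_mem hθ ht)
      rw [Real.dist_eq, Real.dist_eq, Real.coe_nnabs,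
        abs_of_nonneg (by positivity : 0 ≤ |lam0| * ‖d‖)]
      refine h1.trans_eq ?_
      rw [add_sub_add_left_eq_sub, ← sub_smul, norm_smul, Real.norm_eq_abs]
      ring
    exact hlip.continuousOn
  have hder : ∀ t ∈ interior (Set.Icc (0 : ℝ) 1), HasDerivAt (fun s : ℝ =>
      expectedLoss f P (θs + s • d) - lamf / 2 * ‖d‖ ^ 2 * s ^ 2)
      (inner ℝ (gradient (expectedLoss f P) (θs + t • d)) d - lamf * ‖d‖ ^ 2 * t) t := by
    intro t ht
    rw [interior_Icc] at ht
    have h1 := (hd1 t ⟨ht.1.le, ht.2⟩).sub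
      (((hasDerivAt_id t).pow 2).const_mul (lamf / 2 * ‖d‖ ^ 2))
    refine h1.congr_deriv ?_
    simp
    ring
  have hmono := monotoneOn_of_deriv_nonneg (convex_Icc (0 : ℝ) 1) hcont
    (fun t ht => (hder t ht).differentiableAt.differentiableWithinAt)
    (fun t ht => by
      rw [(hder t ht).deriv]
      rw [interior_Icc] at ht
      linarith [hslope t ⟨ht.1.le, ht.2⟩])
  have := hmono (by simp : (0 : ℝ) ∈ Set.Icc (0 : ℝ) 1) (by simp : (1 : ℝ) ∈ Set.Icc (0 : ℝ) 1)
    zero_le_one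
  simp [hd] at this
  linarith

/-- The parameter space is bounded: a Lipschitz function grows at most linearly, the expected loss
at least quadratically. -/
lemma norm_sub_target_le [IsProbabilityMeasure P]
    (hA : Assumptions Θ f P θs S lam0 lam2 lamf φ) {θ : Param p} (hθ : θ ∈ Θ) :
    ‖θ - θs‖ ≤ 2 * |lam0| / lamf := by
  have h1 := hA.expectedLoss_growth hθ
  have h2 := (le_abs_self _).trans (hA.abs_expectedLoss_sub_le hθ hA.target_mem)
  rcases (norm_nonneg (θ - θs)).eq_or_lt with h | h
  · rw [← h]
    have := hA.lamf_pos
    positivity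
  · rw [le_div_iff₀ hA.lamf_pos]
    have : ‖θ - θs‖ * (lamf / 2 * ‖θ - θs‖) ≤ ‖θ - θs‖ * |lam0| := by nlinarith
    have := le_of_mul_le_mul_left this h
    linarith

end Assumptions

/-! ### Independence of the past and the moments of the iterates -/

/-- Averaging over a random variable `Z` independent of `X` first. -/
lemma integral_comp_eq_integral_integral {Ω α β : Type*} {mΩ : MeasurableSpace Ω}
    [MeasurableSpace α] [MeasurableSpace β] {μ : Measure Ω} [IsProbabilityMeasure μ]
    {X : Ω → α} {Z : Ω → β} (hX : Measurable X) (hZ : Measurable Z) (hXZ : IndepFun X Z μ)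
    {F : α × β → ℝ} (hF : Measurable F) (hint : Integrable (fun ω => F (X ω, Z ω)) μ) :
    ∫ ω, F (X ω, Z ω) ∂μ = ∫ ω, ∫ z, F (X ω, z) ∂(μ.map Z) ∂μ := by
  have hlaw := (indepFun_iff_map_prod_eq_prod_map_map hX.aemeasurable hZ.aemeasurable).1 hXZ
  have : IsProbabilityMeasure (μ.map X) := Measure.isProbabilityMeasure_map hX.aemeasurable
  have : IsProbabilityMeasure (μ.map Z) := Measure.isProbabilityMeasure_map hZ.aemeasurable
  have hXZm : AEMeasurable (fun ω => (X ω, Z ω)) μ := (hX.prodMk hZ).aemeasurable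
  have hint' : Integrable F ((μ.map X).prod (μ.map Z)) := by
    rw [← hlaw]
    exact (integrable_map_measure hF.aestronglyMeasurable hXZm).2 hint
  calc ∫ ω, F (X ω, Z ω) ∂μ = ∫ w, F w ∂(μ.map fun ω => (X ω, Z ω)) :=
        (integral_map hXZm hF.aestronglyMeasurable).symm
    _ = ∫ x, ∫ z, F (x, z) ∂(μ.map Z) ∂(μ.map X) := by rw [hlaw, integral_prod _ hint']
    _ = _ := integral_map hX.aemeasurable
        hF.stronglyMeasurable.integral_prod_right'.aestronglyMeasurable

namespace IsImplicitSGD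

variable {Θ : Set (Param p)} {f : ℝ → Y → ℝ} {P : Measure (Param p × Y)}
  {θs : Param p} {S : Matrix (Fin p) (Fin p) ℝ} {lam0 lam2 lamf φ γ1 γ : ℝ}
  {Ω : Type*} {mΩ : MeasurableSpace Ω} {μ : Measure Ω}
  {ℱ : Filtration ℕ mΩ} {ξ : ℕ → Ω → Param p × Y} {θ : ℕ → Ω → Param p}

lemma measurable_iterate (hS : IsImplicitSGD Θ f P γ1 γ μ ℱ ξ θ) (n : ℕ) : Measurable (θ n) :=
  (hS.adapted n).mono (ℱ.le n) le_rfl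

lemma measurable_data (hS : IsImplicitSGD Θ f P γ1 γ μ ℱ ξ θ) (n : ℕ) :
    Measurable (ξ (n + 1)) :=
  (hS.data_measurable n).mono (ℱ.le _) le_rfl

lemma ae_data (hS : IsImplicitSGD Θ f P γ1 γ μ ℱ ξ θ) {q : Param p × Y → Prop}
    (h : ∀ᵐ z ∂P, q z) (n : ℕ) : ∀ᵐ ω ∂μ, q (ξ (n + 1) ω) := by
  rw [← hS.data_law n] at h
  exact ae_of_ae_map (hS.measurable_data n).aemeasurable h

/-- Averaging over the fresh data point, with the past held fixed. -/
lemma integral_comp_data [IsProbabilityMeasure μ] (hS : IsImplicitSGD Θ f P γ1 γ μ ℱ ξ θ)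
    {α : Type*} [MeasurableSpace α] {n : ℕ} {X : Ω → α} (hX : Measurable[ℱ n] X)
    {F : α × (Param p × Y) → ℝ} (hF : Measurable F)
    (hint : Integrable (fun ω => F (X ω, ξ (n + 1) ω)) μ) :
    ∫ ω, F (X ω, ξ (n + 1) ω) ∂μ = ∫ ω, ∫ z, F (X ω, z) ∂P ∂μ := by
  have hind : IndepFun X (ξ (n + 1)) μ := by
    rw [IndepFun_iff_Indep]
    exact (indep_of_indep_of_le_right (hS.data_indep n) hX.comap_le).symm
  rw [← hS.data_law n]
  exact integral_comp_eq_integral_integral (hX.mono (ℱ.le n) le_rfl) (hS.measurable_data n)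
    hind hF hint

lemma ae_norm_sub_le [IsProbabilityMeasure P] (hA : Assumptions Θ f P θs S lam0 lam2 lamf φ)
    (hS : IsImplicitSGD Θ f P γ1 γ μ ℱ ξ θ) (n : ℕ) :
    ∀ᵐ ω ∂μ, ‖θ n ω - θs‖ ≤ 2 * |lam0| / lamf := by
  filter_upwards [hS.mem_space n] with ω hω
  exact hA.norm_sub_target_le hω

lemma memLp_iterate_sub [IsProbabilityMeasure P] [IsProbabilityMeasure μ]
    (hA : Assumptions Θ f P θs S lam0 lam2 lamf φ)
    (hS : IsImplicitSGD Θ f P γ1 γ μ ℱ ξ θ) (n : ℕ) : MemLp (fun ω => θ n ω - θs) 2 μ :=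
  .of_bound ((hS.measurable_iterate n).sub_const θs).aestronglyMeasurable _
    (hS.ae_norm_sub_le hA n)

/-- One step of implicit SGD, bounded with convexity of the loss. The loss difference is evaluated
at the old iterate, which is independent of the new data point. -/
lemma ae_norm_sq_step (hA : Assumptions Θ f P θs S lam0 lam2 lamf φ)
    (hS : IsImplicitSGD Θ f P γ1 γ μ ℱ ξ θ) (hγ1 : 0 < γ1) (n : ℕ) :
    ∀ᵐ ω ∂μ, ‖θ (n + 1) ω - θs‖ ^ 2 ≤ ‖θ n ω - θs‖ ^ 2
      - 2 * rate γ1 γ (n + 1) * (loss f (θ n ω) (ξ (n + 1) ω) - loss f θs (ξ (n + 1) ω))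
      + 2 * rate γ1 γ (n + 1) ^ 2 * lam0 ^ 2 := by
  filter_upwards [hS.update n, hS.mem_space n, hS.mem_space (n + 1),
    hS.ae_data hA.ae_isRegularDatum n] with ω hup h0 h1 hreg
  set r := rate γ1 γ (n + 1)
  have hr : 0 < r := rate_succ_pos γ hγ1 n
  set g := lossGrad f (θ (n + 1) ω) (ξ (n + 1) ω)
  have hg : ‖g‖ ≤ |lam0| := hreg.norm_lossGrad_le hA.convex_space hA.target_interior h1
  have hconv := hreg.loss_sub_le_inner hA.convex_space hA.target_mem h1
  have hlip := (abs_le.1 (hreg.lip _ h1 _ h0)).1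
  have hlip2 : lam0 * ‖θ (n + 1) ω - θ n ω‖ ≤ r * lam0 ^ 2 := by
    have e : θ (n + 1) ω - θ n ω = -(r • g) := by rw [hup]; abel
    rw [e, norm_neg, norm_smul, Real.norm_of_nonneg hr.le, ← sq_abs lam0]
    calc lam0 * (r * ‖g‖) ≤ |lam0| * (r * |lam0|) := by
          gcongr
          exact le_abs_self _
      _ = _ := by ring
  have hsq : ‖θ n ω - θs‖ ^ 2 = ‖θ (n + 1) ω - θs‖ ^ 2
      + 2 * r * inner ℝ g (θ (n + 1) ω - θs) + r ^ 2 * ‖g‖ ^ 2 := by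
    have e : θ n ω - θs = (θ (n + 1) ω - θs) + r • g := by rw [hup]; abel
    rw [e, norm_add_sq_real, inner_smul_right, norm_smul, Real.norm_of_nonneg hr.le,
      real_inner_comm]
    ring
  have h2 : loss f (θ n ω) (ξ (n + 1) ω) - loss f θs (ξ (n + 1) ω) - r * lam0 ^ 2
      ≤ inner ℝ g (θ (n + 1) ω - θs) := by linarith
  have h3 := mul_le_mul_of_nonneg_left h2 (by positivity : 0 ≤ 2 * r)
  have h4 : 0 ≤ r ^ 2 * ‖g‖ ^ 2 := by positivity
  rw [hsq]
  linarith

/-- The square of the one-step bound. All terms but the drift are of third order in the learning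
rate or absorbed by a fraction of the contraction. -/
lemma ae_norm_pow_four_step [IsProbabilityMeasure P]
    (hA : Assumptions Θ f P θs S lam0 lam2 lamf φ)
    (hS : IsImplicitSGD Θ f P γ1 γ μ ℱ ξ θ) (hγ1 : 0 < γ1) (hγ : 0 ≤ γ) (n : ℕ) :
    ∀ᵐ ω ∂μ, ‖θ (n + 1) ω - θs‖ ^ 4 ≤ (1 + lamf * rate γ1 γ (n + 1)) * ‖θ n ω - θs‖ ^ 4
      - 4 * rate γ1 γ (n + 1) * (‖θ n ω - θs‖ ^ 2 *
        (loss f (θ n ω) (ξ (n + 1) ω) - loss f θs (ξ (n + 1) ω)))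
      + (16 * lam0 ^ 4 / lamf + 8 * |lam0| ^ 3 * (2 * |lam0| / lamf) + 4 * γ1 * lam0 ^ 4)
        * rate γ1 γ (n + 1) ^ 3 := by
  filter_upwards [hS.ae_norm_sq_step hA hγ1 n, hS.mem_space n, hS.ae_norm_sub_le hA n,
    hS.ae_data hA.ae_isRegularDatum n] with ω hstep h0 hD hreg
  have hlip := hreg.lip _ h0 _ hA.target_mem
  have hr : 0 < rate γ1 γ (n + 1) := rate_succ_pos γ hγ1 n
  have hr1 : rate γ1 γ (n + 1) ≤ γ1 := rate_succ_le hγ1 hγ n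
  have hlf := hA.lamf_pos
  generalize rate γ1 γ (n + 1) = r at *
  generalize loss f (θ n ω) (ξ (n + 1) ω) - loss f θs (ξ (n + 1) ω) = Δ at *
  generalize ‖θ (n + 1) ω - θs‖ = b at *
  have ha : 0 ≤ ‖θ n ω - θs‖ := norm_nonneg _
  generalize ‖θ n ω - θs‖ = a at *
  generalize 2 * |lam0| / lamf = D at *
  have hl : 0 ≤ |lam0| := abs_nonneg _
  have hΔ : |Δ| ≤ |lam0| * a := hlip.trans (by gcongr; exact le_abs_self _)
  rw [← sq_abs lam0] at hstep
  rw [show lam0 ^ 4 = |lam0| ^ 4 by rw [Even.pow_abs (by decide)]]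
  generalize |lam0| = l at *
  have hsq : b ^ 4 ≤ (a ^ 2 - 2 * r * Δ + 2 * r ^ 2 * l ^ 2) ^ 2 := by
    rw [show b ^ 4 = (b ^ 2) ^ 2 by ring]
    exact pow_le_pow_left₀ (by positivity) hstep 2
  have h1 : 4 * r ^ 2 * Δ ^ 2 ≤ 4 * r ^ 2 * (l ^ 2 * a ^ 2) := by
    gcongr
    rw [← sq_abs Δ, ← mul_pow]
    gcongr
  have h2 : -(8 * r ^ 3 * l ^ 2 * Δ) ≤ 8 * l ^ 3 * D * r ^ 3 := by
    have : -Δ ≤ l * D := (neg_le_abs Δ).trans (hΔ.trans (by gcongr))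
    calc -(8 * r ^ 3 * l ^ 2 * Δ) = 8 * r ^ 3 * l ^ 2 * -Δ := by ring
      _ ≤ 8 * r ^ 3 * l ^ 2 * (l * D) := by gcongr
      _ = _ := by ring
  have h3 : 4 * r ^ 4 * l ^ 4 ≤ 4 * γ1 * l ^ 4 * r ^ 3 := by
    calc 4 * r ^ 4 * l ^ 4 = 4 * r * l ^ 4 * r ^ 3 := by ring
      _ ≤ _ := by gcongr
  -- the mixed term is split by the inequality of arithmetic and geometric means
  have h4 : 8 * r ^ 2 * l ^ 2 * a ^ 2 ≤ lamf * r * a ^ 4 + 16 * l ^ 4 / lamf * r ^ 3 := by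
    have e : lamf * r * a ^ 4 + 16 * l ^ 4 / lamf * r ^ 3 - 8 * r ^ 2 * l ^ 2 * a ^ 2
        = r / lamf * (lamf * a ^ 2 - 4 * l ^ 2 * r) ^ 2 := by
      field_simp
      ring
    have : 0 ≤ r / lamf * (lamf * a ^ 2 - 4 * l ^ 2 * r) ^ 2 := by positivity
    linarith
  nlinarith [hsq, h1, h2, h3, h4]

end IsImplicitSGD

/-- The fourth moment of the error of implicit SGD is of the order of the squared learning rate,
uniformly over the initial conditions. -/
lemma Assumptions.exists_fourth_moment_le {Θ : Set (Param p)} {f : ℝ → Y → ℝ}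
    {P : Measure (Param p × Y)} [IsProbabilityMeasure P]
    {θs : Param p} {S : Matrix (Fin p) (Fin p) ℝ} {lam0 lam2 lamf φ γ1 γ : ℝ}
    (hA : Assumptions Θ f P θs S lam0 lam2 lamf φ) (hγ1 : 0 < γ1)
    (hγ : γ ∈ Set.Ioo (1 / 2 : ℝ) 1) :
    ∃ A : ℝ, 0 ≤ A ∧ ∀ {Ω : Type*} {mΩ : MeasurableSpace Ω} (μ : Measure Ω)
      [IsProbabilityMeasure μ] (ℱ : Filtration ℕ mΩ)
      (ξ : ℕ → Ω → Param p × Y) (θ : ℕ → Ω → Param p), IsImplicitSGD Θ f P γ1 γ μ ℱ ξ θ →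
      ∀ n, 1 ≤ n → ∫ ω, ‖θ n ω - θs‖ ^ 4 ∂μ ≤ A * (n : ℝ) ^ (-(2 * γ)) := by
  have hlf := hA.lamf_pos
  set C := 16 * lam0 ^ 4 / lamf + 8 * |lam0| ^ 3 * (2 * |lam0| / lamf) + 4 * γ1 * lam0 ^ 4
    with hC
  set D := 2 * |lam0| / lamf with hD
  have hC0 : 0 ≤ C := by positivity
  obtain ⟨A, hA0, hdec⟩ := exists_decay_of_recursion (B := D ^ 4) hlf hC0 (by positivity) hγ1 hγ
  refine ⟨A, hA0, fun {Ω mΩ} μ _ ℱ ξ θ hS => hdec (fun n => ∫ ω, ‖θ n ω - θs‖ ^ 4 ∂μ) ?_ ?_⟩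
  all_goals
    have hmeas : ∀ n, Measurable fun ω => ‖θ n ω - θs‖ := fun n =>
      ((hS.measurable_iterate n).sub_const θs).norm
    have hb4 : ∀ n, ∀ᵐ ω ∂μ, ‖‖θ n ω - θs‖ ^ 4‖ ≤ D ^ 4 := by
      intro n
      filter_upwards [hS.ae_norm_sub_le hA n] with ω hω
      rw [Real.norm_of_nonneg (by positivity)]
      gcongr
    have hint : ∀ n, Integrable (fun ω => ‖θ n ω - θs‖ ^ 4) μ := fun n =>
      .of_bound ((hmeas n).pow_const 4).aestronglyMeasurable _ (hb4 n)
    intro n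
  · have := norm_integral_le_of_norm_le_const (hb4 n)
    rw [probReal_univ, mul_one] at this
    exact (le_abs_self _).trans this
  have hF : Measurable fun w : Param p × (Param p × Y) =>
      ‖w.1 - θs‖ ^ 2 * (loss f w.1 w.2 - loss f θs w.2) :=
    ((measurable_fst.sub_const θs).norm.pow_const 2).mul
      ((measurable_loss_uncurry hA.measurable_loss).sub
        ((measurable_loss_apply hA.measurable_loss θs).comp measurable_snd))
  have hFint : Integrable (fun ω => ‖θ n ω - θs‖ ^ 2 *
      (loss f (θ n ω) (ξ (n + 1) ω) - loss f θs (ξ (n + 1) ω))) μ := by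
    refine .of_bound (hF.comp ((hS.measurable_iterate n).prodMk
      (hS.measurable_data n))).aestronglyMeasurable (D ^ 2 * (|lam0| * D)) ?_
    filter_upwards [hS.ae_norm_sub_le hA n, hS.mem_space n,
      hS.ae_data hA.ae_isRegularDatum n] with ω h1 h2 h3
    rw [norm_mul, Real.norm_of_nonneg (by positivity : 0 ≤ ‖θ n ω - θs‖ ^ 2), Real.norm_eq_abs]
    have h4 : |loss f (θ n ω) (ξ (n + 1) ω) - loss f θs (ξ (n + 1) ω)| ≤ |lam0| * D := by
      refine (h3.lip _ h2 _ hA.target_mem).trans ?_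
      calc lam0 * ‖θ n ω - θs‖ ≤ |lam0| * ‖θ n ω - θs‖ := by gcongr; exact le_abs_self _
        _ ≤ _ := by gcongr
    gcongr
  have hdrift : lamf / 2 * ∫ ω, ‖θ n ω - θs‖ ^ 4 ∂μ ≤ ∫ ω, ‖θ n ω - θs‖ ^ 2 *
      (loss f (θ n ω) (ξ (n + 1) ω) - loss f θs (ξ (n + 1) ω)) ∂μ := by
    rw [hS.integral_comp_data (hS.adapted n) hF hFint, ← integral_const_mul]
    have hinner : ∀ᵐ ω ∂μ, ∫ z, ‖θ n ω - θs‖ ^ 2 * (loss f (θ n ω) z - loss f θs z) ∂P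
        = ‖θ n ω - θs‖ ^ 2 * (expectedLoss f P (θ n ω) - expectedLoss f P θs) := by
      filter_upwards [hS.mem_space n] with ω hω
      rw [integral_const_mul, integral_sub (hA.integrable_loss _ hω)
        (hA.integrable_loss _ hA.target_mem)]
      rfl
    refine integral_mono_ae ((hint n).const_mul _) ?_ ?_
    · refine .of_bound ?_ (D ^ 2 * (|lam0| * D)) ?_
      · exact (hF.stronglyMeasurable.integral_prod_right'.comp_measurable
          (hS.measurable_iterate n)).aestronglyMeasurable
      filter_upwards [hinner, hS.ae_norm_sub_le hA n, hS.mem_space n] with ω h1 h2 h3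
      rw [h1, norm_mul, Real.norm_of_nonneg (by positivity : 0 ≤ ‖θ n ω - θs‖ ^ 2),
        Real.norm_eq_abs]
      have h4 := hA.abs_expectedLoss_sub_le h3 hA.target_mem
      have h5 : |expectedLoss f P (θ n ω) - expectedLoss f P θs| ≤ |lam0| * D :=
        h4.trans (by gcongr)
      gcongr
    · filter_upwards [hinner, hS.mem_space n] with ω h1 h2
      rw [h1]
      have := mul_le_mul_of_nonneg_left (hA.expectedLoss_growth h2) (sq_nonneg ‖θ n ω - θs‖)
      calc lamf / 2 * ‖θ n ω - θs‖ ^ 4 = ‖θ n ω - θs‖ ^ 2 * (lamf / 2 * ‖θ n ω - θs‖ ^ 2) := by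
            ring
        _ ≤ _ := this
  have hI1 : Integrable (fun ω => (1 + lamf * rate γ1 γ (n + 1)) * ‖θ n ω - θs‖ ^ 4
      - 4 * rate γ1 γ (n + 1) * (‖θ n ω - θs‖ ^ 2 *
        (loss f (θ n ω) (ξ (n + 1) ω) - loss f θs (ξ (n + 1) ω)))) μ :=
    ((hint n).const_mul _).sub (hFint.const_mul _)
  have hmono := integral_mono_ae (hint (n + 1)) (hI1.add (integrable_const _))
    (hS.ae_norm_pow_four_step hA hγ1 (by linarith [hγ.1]) n)
  simp only [Pi.add_apply] at hmono
  rw [integral_add hI1 (integrable_const _),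
    integral_sub ((hint n).const_mul _) (hFint.const_mul _), integral_const_mul,
    integral_const_mul, integral_const, probReal_univ, one_smul] at hmono
  have hr : 0 < rate γ1 γ (n + 1) := rate_succ_pos γ hγ1 n
  have := mul_le_mul_of_nonneg_left hdrift (by positivity : 0 ≤ 4 * rate γ1 γ (n + 1))
  linarith

/-! ### The Hessian matrix at the target -/

lemma toEuclideanCLM_hessianMat (g : Param p → ℝ) (θ : Param p) :
    Matrix.toEuclideanCLM (𝕜 := ℝ) (hessianMat g θ) = hessianOp g θ := by
  refine ContinuousLinearMap.ext fun v => ?_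
  ext i
  conv_rhs => rw [← (EuclideanSpace.basisFun (Fin p) ℝ).sum_repr v]
  simp [hessianMat, Matrix.ofLp_toEuclideanCLM, Matrix.mulVec, dotProduct, mul_comm]

namespace Assumptions

variable {Θ : Set (Param p)} {f : ℝ → Y → ℝ} {P : Measure (Param p × Y)}
  {θs : Param p} {S : Matrix (Fin p) (Fin p) ℝ} {lam0 lam2 lamf φ : ℝ}

lemma inner_hessianOp_comm [IsProbabilityMeasure P]
    (hA : Assumptions Θ f P θs S lam0 lam2 lamf φ) (u v : Param p) :
    inner ℝ u (hessianOp (expectedLoss f P) θs v)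
      = inner ℝ v (hessianOp (expectedLoss f P) θs u) := by
  have hi := hA.integrable_hessianOp hA.target_interior
  rw [hA.hessianOp_expectedLoss hA.target_interior, ContinuousLinearMap.integral_apply hi,
    ContinuousLinearMap.integral_apply hi, ← integral_inner (hi.apply_continuousLinearMap v),
    ← integral_inner (hi.apply_continuousLinearMap u)]
  refine integral_congr_ae ?_
  filter_upwards [hA.ae_isRegularDatum] with ξ hξ
  exact hξ.inner_hessianOp_comm hA.target_mem u v

lemma isSymm_hessianMat [IsProbabilityMeasure P]
    (hA : Assumptions Θ f P θs S lam0 lam2 lamf φ) :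
    (hessianMat (expectedLoss f P) θs).IsSymm := by
  ext i j
  have := hA.inner_hessianOp_comm (EuclideanSpace.single i 1) (EuclideanSpace.single j 1)
  simpa [hessianMat, EuclideanSpace.inner_single_left] using this.symm

lemma isUnit_det_hessianMat [IsProbabilityMeasure P]
    (hA : Assumptions Θ f P θs S lam0 lam2 lamf φ) :
    IsUnit (hessianMat (expectedLoss f P) θs).det := by
  rw [isUnit_iff_ne_zero]
  intro h
  obtain ⟨v, hv, hv0⟩ := Matrix.exists_mulVec_eq_zero_iff.2 h
  have h1 : hessianOp (expectedLoss f P) θs (WithLp.toLp 2 v) = 0 := by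
    rw [← toEuclideanCLM_hessianMat]
    ext i
    simp [hv0]
  have h2 := hA.le_inner_hessianOp hA.target_interior (WithLp.toLp 2 v)
  rw [h1, inner_zero_right] at h2
  have h3 : WithLp.toLp 2 v ≠ 0 := by simpa using hv
  have := hA.lamf_pos
  have : 0 < lamf * ‖WithLp.toLp 2 v‖ ^ 2 := by positivity
  linarith

/-- The inverse of the Hessian at the target, as an operator. -/
lemma inv_hessianMat_apply [IsProbabilityMeasure P]
    (hA : Assumptions Θ f P θs S lam0 lam2 lamf φ) (v : Param p) :
    Matrix.toEuclideanCLM (𝕜 := ℝ) (hessianMat (expectedLoss f P) θs)⁻¹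
      (hessianOp (expectedLoss f P) θs v) = v := by
  rw [← toEuclideanCLM_hessianMat, ← mul_apply_eq_comp, ← map_mul,
    Matrix.nonsing_inv_mul _ hA.isUnit_det_hessianMat, map_one]
  rfl

lemma memLp_lossGrad [IsProbabilityMeasure P]
    (hA : Assumptions Θ f P θs S lam0 lam2 lamf φ) {θ : Param p} (hθ : θ ∈ Θ) :
    MemLp (lossGrad f θ) 2 P :=
  .of_bound (hA.aestronglyMeasurable_lossGrad hθ) _ (hA.ae_norm_lossGrad_le hθ)

lemma memLp_lossGrad_apply [IsProbabilityMeasure P]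
    (hA : Assumptions Θ f P θs S lam0 lam2 lamf φ) {θ : Param p} (hθ : θ ∈ Θ) (i : Fin p) :
    MemLp (fun ξ => lossGrad f θ ξ i) 2 P :=
  (EuclideanSpace.proj (𝕜 := ℝ) i).comp_memLp' (hA.memLp_lossGrad hθ)

lemma noiseCov_target_apply [IsProbabilityMeasure P]
    (hA : Assumptions Θ f P θs S lam0 lam2 lamf φ) (i j : Fin p) :
    noiseCov f P θs i j = ∫ ξ, lossGrad f θs ξ i * lossGrad f θs ξ j ∂P := by
  simp [noiseCov, hA.gradNoise_target]

/-- The second moment of `H⁻¹ ∇L(θs, ξ)` is the trace which governs the leading term. -/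
lemma integral_norm_sq_inv_hessian_lossGrad_le [IsProbabilityMeasure P]
    (hA : Assumptions Θ f P θs S lam0 lam2 lamf φ) :
    ∫ ξ, ‖Matrix.toEuclideanCLM (𝕜 := ℝ) (hessianMat (expectedLoss f P) θs)⁻¹
        (lossGrad f θs ξ)‖ ^ 2 ∂P
      ≤ ((hessianMat (expectedLoss f P) θs)⁻¹ * S
          * (hessianMat (expectedLoss f P) θs)⁻¹).trace := by
  have hsymm : ((hessianMat (expectedLoss f P) θs)⁻¹).IsSymm := by
    rw [Matrix.IsSymm, Matrix.transpose_nonsing_inv, hA.isSymm_hessianMat]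
  set G := (hessianMat (expectedLoss f P) θs)⁻¹ with hG
  have hint : ∀ i j, Integrable (fun ξ => lossGrad f θs ξ i * lossGrad f θs ξ j) P :=
    fun i j => (hA.memLp_lossGrad_apply hA.target_mem i).integrable_mul
      (hA.memLp_lossGrad_apply hA.target_mem j)
  have e1 : ∀ ξ, ‖Matrix.toEuclideanCLM (𝕜 := ℝ) G (lossGrad f θs ξ)‖ ^ 2
      = ∑ i, ∑ j, ∑ k, (G i j * G i k) * (lossGrad f θs ξ j * lossGrad f θs ξ k) := by
    intro ξ
    rw [EuclideanSpace.norm_sq_eq]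
    refine Finset.sum_congr rfl fun i _ => ?_
    rw [Real.norm_eq_abs, sq_abs, Matrix.ofLp_toEuclideanCLM, sq, Matrix.mulVec, dotProduct,
      Finset.sum_mul_sum]
    refine Finset.sum_congr rfl fun j _ => Finset.sum_congr rfl fun k _ => ?_
    ring
  have e2 : ∫ ξ, ‖Matrix.toEuclideanCLM (𝕜 := ℝ) G (lossGrad f θs ξ)‖ ^ 2 ∂P
      = (G * noiseCov f P θs * G).trace := by
    simp only [e1]
    rw [integral_finsetSum _ fun i _ => integrable_finsetSum _ fun j _ =>
      integrable_finsetSum _ fun k _ => (hint j k).const_mul _]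
    rw [Matrix.trace]
    refine Finset.sum_congr rfl fun i _ => ?_
    rw [integral_finsetSum _ fun j _ => integrable_finsetSum _ fun k _ =>
      (hint j k).const_mul _]
    simp only [Matrix.diag_apply, Matrix.mul_apply, Finset.sum_mul]
    rw [Finset.sum_comm]
    refine Finset.sum_congr rfl fun j _ => ?_
    rw [integral_finsetSum _ fun k _ => (hint j k).const_mul _]
    refine Finset.sum_congr rfl fun k _ => ?_
    rw [integral_const_mul, hA.noiseCov_target_apply, hsymm.apply i k]
    ring
  have hps := (hA.noise_le.mul_mul_conjTranspose_same G).trace_nonneg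
  rw [Matrix.conjTranspose_eq_transpose_of_trivial, hsymm.eq, Matrix.mul_sub, Matrix.sub_mul,
    Matrix.trace_sub] at hps
  rw [e2]
  linarith

end Assumptions

/-! ### Norms in `L²` and sums of martingale differences -/

section L2

variable {Ω E : Type*} {mΩ : MeasurableSpace Ω} {μ : Measure Ω} [NormedAddCommGroup E]

lemma lpNorm_two_eq_sqrt {g : Ω → E} (hg : AEStronglyMeasurable g μ) :
    lpNorm g 2 μ = √(∫ ω, ‖g ω‖ ^ 2 ∂μ) := by
  rw [lpNorm_eq_integral_norm_rpow_toReal (by simp) (by simp) hg, Real.sqrt_eq_rpow]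
  simp

lemma lpNorm_two_le_of_ae_le {g : Ω → E} {h : Ω → ℝ} (hg : AEStronglyMeasurable g μ)
    (hh : MemLp h 2 μ) (hle : ∀ᵐ ω ∂μ, ‖g ω‖ ≤ h ω) : lpNorm g 2 μ ≤ lpNorm h 2 μ := by
  rw [← toReal_eLpNorm hg, ← toReal_eLpNorm hh.1]
  exact ENNReal.toReal_mono hh.2.ne (eLpNorm_mono_ae_real hle)

lemma lpNorm_two_le_of_ae_le_const [IsProbabilityMeasure μ] {g : Ω → E} {c : ℝ} (hc : 0 ≤ c)
    (hg : AEStronglyMeasurable g μ) (hle : ∀ᵐ ω ∂μ, ‖g ω‖ ≤ c) : lpNorm g 2 μ ≤ c := by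
  refine (lpNorm_two_le_of_ae_le hg (memLp_const c) hle).trans_eq ?_
  rw [lpNorm_const (by simp) (IsProbabilityMeasure.ne_zero μ)]
  simp [abs_of_nonneg hc]

lemma sq_lpNorm_two_le_lpNorm_norm_sq [IsProbabilityMeasure μ] {g : Ω → E}
    (hg : AEStronglyMeasurable g μ) (h4 : MemLp (fun ω => ‖g ω‖ ^ 2) 2 μ) :
    lpNorm g 2 μ ^ 2 ≤ lpNorm (fun ω => ‖g ω‖ ^ 2) 2 μ := by
  rw [lpNorm_two_eq_sqrt hg, Real.sq_sqrt (by positivity), ← toReal_eLpNorm h4.1]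
  have h1 : (eLpNorm (fun ω => ‖g ω‖ ^ 2) 1 μ).toReal
      ≤ (eLpNorm (fun ω => ‖g ω‖ ^ 2) 2 μ).toReal :=
    ENNReal.toReal_mono h4.2.ne (eLpNorm_le_eLpNorm_of_exponent_le (by norm_num) h4.1)
  rw [toReal_eLpNorm h4.1, lpNorm_one_eq_integral_norm h4.1] at h1
  simpa using h1

end L2

namespace IsImplicitSGD

variable {Θ : Set (Param p)} {f : ℝ → Y → ℝ} {P : Measure (Param p × Y)}
  {θs : Param p} {S : Matrix (Fin p) (Fin p) ℝ} {lam0 lam2 lamf φ γ1 γ : ℝ}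
  {Ω : Type*} {mΩ : MeasurableSpace Ω} {μ : Measure Ω} [IsProbabilityMeasure μ]
  {ℱ : Filtration ℕ mΩ} {ξ : ℕ → Ω → Param p × Y} {θ : ℕ → Ω → Param p}

/-- Martingale differences, functions of the current iterate and the new data point, are
orthogonal in `L²`. -/
lemma integral_norm_sq_sum (hS : IsImplicitSGD Θ f P γ1 γ μ ℱ ξ θ)
    {T : Param p → Param p × Y → Param p} (hT : Measurable (Function.uncurry T))
    (hL2 : ∀ n, MemLp (fun ω => T (θ n ω) (ξ (n + 1) ω)) 2 μ)
    (hmean : ∀ u t : Param p, ∫ z, inner ℝ u (T t z) ∂P = 0) (n : ℕ) :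
    ∫ ω, ‖∑ i ∈ Finset.range n, T (θ i ω) (ξ (i + 1) ω)‖ ^ 2 ∂μ
      = ∑ i ∈ Finset.range n, ∫ ω, ‖T (θ i ω) (ξ (i + 1) ω)‖ ^ 2 ∂μ := by
  induction n with
  | zero => simp
  | succ n ih =>
    set s : Ω → Param p := fun ω => ∑ i ∈ Finset.range n, T (θ i ω) (ξ (i + 1) ω) with hs
    set y : Ω → Param p := fun ω => T (θ n ω) (ξ (n + 1) ω) with hy
    have hsL : MemLp s 2 μ := memLp_finsetSum _ fun i _ => hL2 i
    have hyL : MemLp y 2 μ := hL2 n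
    have hsm : Measurable[ℱ n] s := by
      refine Finset.measurable_sum _ fun i hi => ?_
      have hi' : i + 1 ≤ n := Finset.mem_range.1 hi
      exact hT.comp (((hS.adapted i).mono (ℱ.mono (by omega)) le_rfl).prodMk
        ((hS.data_measurable i).mono (ℱ.mono hi') le_rfl))
    have hF : Measurable fun w : (Param p × Param p) × (Param p × Y) =>
        inner ℝ w.1.1 (T w.1.2 w.2) := by
      have h1 : Measurable fun w : (Param p × Param p) × (Param p × Y) => T w.1.2 w.2 :=
        hT.comp ((measurable_snd.comp measurable_fst).prodMk measurable_snd)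
      exact (measurable_fst.comp measurable_fst).inner h1
    have hi : Integrable (fun ω => inner ℝ (s ω) (y ω)) μ := by
      refine ((hsL.norm.integrable_mul hyL.norm)).mono'
        (hsL.1.inner hyL.1) (Eventually.of_forall fun ω => norm_inner_le_norm _ _)
    have hcross : ∫ ω, inner ℝ (s ω) (y ω) ∂μ = 0 := by
      have h1 := hS.integral_comp_data (n := n) (X := fun ω => (s ω, θ n ω))
        (hsm.prodMk (hS.adapted n)) hF hi
      simp only [hmean, integral_zero] at h1
      exact h1
    have hexp : ∀ ω, ‖∑ i ∈ Finset.range (n + 1), T (θ i ω) (ξ (i + 1) ω)‖ ^ 2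
        = ‖s ω‖ ^ 2 + 2 * inner ℝ (s ω) (y ω) + ‖y ω‖ ^ 2 := by
      intro ω
      rw [Finset.sum_range_succ]
      exact norm_add_sq_real _ _
    simp only [hexp]
    have hi1 : Integrable (fun ω => ‖s ω‖ ^ 2) μ := hsL.integrable_norm_pow (by simp)
    have hi2 : Integrable (fun ω => 2 * inner ℝ (s ω) (y ω)) μ :=
      hi.const_mul 2
    have hi3 : Integrable (fun ω => ‖y ω‖ ^ 2) μ := hyL.integrable_norm_pow (by simp)
    have hi12 : Integrable (fun ω => ‖s ω‖ ^ 2 + 2 * inner ℝ (s ω) (y ω)) μ := hi1.add hi2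
    rw [integral_add hi12 hi3, integral_add hi1 hi2, integral_const_mul, hcross,
      Finset.sum_range_succ, ih]
    simp [hy]

end IsImplicitSGD

/-! ### Averaging -/

/-- Summation by parts. -/
lemma sum_smul_sub_eq {E : Type*} [AddCommGroup E] [Module ℝ E] (c : ℕ → ℝ) (b : ℕ → E) (n : ℕ) :
    ∑ i ∈ Finset.range (n + 1), c i • (b i - b (i + 1))
      = c 0 • b 0 - c n • b (n + 1)
        + ∑ i ∈ Finset.range n, (c (i + 1) - c i) • b (i + 1) := by
  induction n with
  | zero => simp [smul_sub]
  | succ n ih =>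
    rw [Finset.sum_range_succ, ih, Finset.sum_range_succ _ n]
    module

lemma inv_rate_succ {γ1 : ℝ} (γ : ℝ) (n : ℕ) :
    (rate γ1 γ (n + 1))⁻¹ = γ1⁻¹ * ((n : ℝ) + 1) ^ γ := by
  rw [rate_succ, mul_inv, Real.rpow_neg (by positivity), inv_inv]

section Sums

variable {Ω E : Type*} {mΩ : MeasurableSpace Ω} {μ : Measure Ω} [NormedAddCommGroup E]
  {b : ℕ → Ω → E} {γ1 γ D A : ℝ}

/-- The increments of the iterates, weighted with the inverse learning rates, contribute a term of
order `n^{γ/2}` to the sum. -/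
lemma lpNorm_sum_inv_rate_smul_sub_le [NormedSpace ℝ E] (hγ1 : 0 < γ1) (hγ : γ ∈ Set.Ioo (1 / 2 : ℝ) 1)
    (hA : 0 ≤ A) (hb : ∀ n, MemLp (b n) 2 μ) (h0 : lpNorm (b 0) 2 μ ≤ D)
    (hn : ∀ n : ℕ, lpNorm (b (n + 1)) 2 μ ≤ A * ((n : ℝ) + 1) ^ (-(γ / 2))) (n : ℕ) :
    lpNorm (fun ω => ∑ i ∈ Finset.range (n + 1),
        (rate γ1 γ (i + 1))⁻¹ • (b i ω - b (i + 1) ω)) 2 μ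
      ≤ γ1⁻¹ * (D + A + 2 * A / γ) * ((n : ℝ) + 1) ^ (γ / 2) := by
  obtain ⟨hγ0, hγ2⟩ := hγ
  set c : ℕ → ℝ := fun i => (rate γ1 γ (i + 1))⁻¹ with hc
  have hD : 0 ≤ D := lpNorm_nonneg.trans h0
  have e : (fun ω => ∑ i ∈ Finset.range (n + 1), c i • (b i ω - b (i + 1) ω))
      = (c 0 • b 0 - c n • b (n + 1))
        + ∑ i ∈ Finset.range n, (c (i + 1) - c i) • b (i + 1) := by
    funext ω
    simp only [Pi.add_apply, Pi.sub_apply, Pi.smul_apply, Finset.sum_apply]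
    exact sum_smul_sub_eq c (fun i => b i ω) n
  rw [e]
  have hpos : (0 : ℝ) < (n : ℝ) + 1 := by positivity
  have hx1 : (1 : ℝ) ≤ ((n : ℝ) + 1) ^ (γ / 2) :=
    Real.one_le_rpow (by linarith [n.cast_nonneg (α := ℝ)]) (by linarith)
  have hγi : 0 < γ1⁻¹ := by positivity
  have t1 : lpNorm (c 0 • b 0) 2 μ ≤ γ1⁻¹ * D * ((n : ℝ) + 1) ^ (γ / 2) := by
    rw [lpNorm_const_smul]
    simp only [hc, inv_rate_succ, Nat.cast_zero, zero_add, Real.one_rpow, mul_one, norm_inv,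
      coe_nnnorm, Real.norm_of_nonneg hγ1.le]
    calc γ1⁻¹ * lpNorm (b 0) 2 μ ≤ γ1⁻¹ * D * 1 := by rw [mul_one]; gcongr
      _ ≤ _ := by gcongr
  have t2 : lpNorm (c n • b (n + 1)) 2 μ ≤ γ1⁻¹ * A * ((n : ℝ) + 1) ^ (γ / 2) := by
    rw [lpNorm_const_smul]
    simp only [hc, inv_rate_succ, coe_nnnorm]
    rw [Real.norm_of_nonneg (by positivity)]
    calc γ1⁻¹ * ((n : ℝ) + 1) ^ γ * lpNorm (b (n + 1)) 2 μ
        ≤ γ1⁻¹ * ((n : ℝ) + 1) ^ γ * (A * ((n : ℝ) + 1) ^ (-(γ / 2))) := by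
          gcongr
          exact hn n
      _ = γ1⁻¹ * A * (((n : ℝ) + 1) ^ γ * ((n : ℝ) + 1) ^ (-(γ / 2))) := by ring
      _ = _ := by
          rw [← Real.rpow_add hpos]
          congr 2
          ring
  have t3 : ∀ i ∈ Finset.range n, lpNorm ((c (i + 1) - c i) • b (i + 1)) 2 μ
      ≤ γ1⁻¹ * A * ((i : ℝ) + 1) ^ (γ / 2 - 1) := by
    intro i _
    have hi : (0 : ℝ) < (i : ℝ) + 1 := by positivity
    have hci : c (i + 1) - c i = γ1⁻¹ * (((i : ℝ) + 1 + 1) ^ γ - ((i : ℝ) + 1) ^ γ) := by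
      simp only [hc, inv_rate_succ]
      push_cast
      ring
    have hup : ((i : ℝ) + 1 + 1) ^ γ - ((i : ℝ) + 1) ^ γ ≤ ((i : ℝ) + 1) ^ (γ - 1) := by
      have := rpow_succ_sub_le (s := γ) (by linarith) hγ2.le (n := i + 1) (by omega)
      push_cast at this
      exact this
    have hlow : 0 ≤ ((i : ℝ) + 1 + 1) ^ γ - ((i : ℝ) + 1) ^ γ :=
      sub_nonneg.2 (Real.rpow_le_rpow hi.le (by linarith) (by linarith))
    rw [lpNorm_const_smul, coe_nnnorm, hci, Real.norm_of_nonneg (by positivity)]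
    calc γ1⁻¹ * (((i : ℝ) + 1 + 1) ^ γ - ((i : ℝ) + 1) ^ γ) * lpNorm (b (i + 1)) 2 μ
        ≤ γ1⁻¹ * ((i : ℝ) + 1) ^ (γ - 1) * (A * ((i : ℝ) + 1) ^ (-(γ / 2))) := by
          have := hn i
          have := lpNorm_nonneg (f := b (i + 1)) (p := 2) (μ := μ)
          gcongr
      _ = γ1⁻¹ * A * (((i : ℝ) + 1) ^ (γ - 1) * ((i : ℝ) + 1) ^ (-(γ / 2))) := by ring
      _ = _ := by
          rw [← Real.rpow_add hi]
          congr 2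
          ring
  have t4 : lpNorm (∑ i ∈ Finset.range n, (c (i + 1) - c i) • b (i + 1)) 2 μ
      ≤ γ1⁻¹ * (2 * A / γ) * ((n : ℝ) + 1) ^ (γ / 2) := by
    refine (lpNorm_sum_le (fun i _ => (hb (i + 1)).const_smul _) (by norm_num)).trans
      ((Finset.sum_le_sum t3).trans ?_)
    rw [← Finset.mul_sum]
    have h1 := sum_rpow_sub_one_le (s := γ / 2) (by linarith) (by linarith) n
    have h2 : (n : ℝ) ^ (γ / 2) ≤ ((n : ℝ) + 1) ^ (γ / 2) :=
      Real.rpow_le_rpow n.cast_nonneg (by linarith) (by linarith)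
    have hγp : 0 < γ := by linarith
    calc γ1⁻¹ * A * ∑ i ∈ Finset.range n, ((i : ℝ) + 1) ^ (γ / 2 - 1)
        ≤ γ1⁻¹ * A * (((n : ℝ) + 1) ^ (γ / 2) / (γ / 2)) := by
          gcongr
          exact h1.trans (by gcongr)
      _ = _ := by field_simp
  have hm : MemLp (c 0 • b 0 - c n • b (n + 1)) 2 μ :=
    ((hb 0).const_smul _).sub ((hb (n + 1)).const_smul _)
  have s1 := lpNorm_add_le hm (by norm_num)
    (g := ∑ i ∈ Finset.range n, (c (i + 1) - c i) • b (i + 1))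
  have s2 := lpNorm_sub_le ((hb 0).const_smul (c 0)) (by norm_num) (g := c n • b (n + 1))
  calc _ ≤ _ := s1
    _ ≤ γ1⁻¹ * D * ((n : ℝ) + 1) ^ (γ / 2) + γ1⁻¹ * A * ((n : ℝ) + 1) ^ (γ / 2)
        + γ1⁻¹ * (2 * A / γ) * ((n : ℝ) + 1) ^ (γ / 2) := by linarith
    _ = _ := by ring

/-- The sum of the mean squared errors is at most of order `n^{1-γ}`, hence of order `n^γ`. -/
lemma sum_lpNorm_sq_le (hγ : γ ∈ Set.Ioo (1 / 2 : ℝ) 1) (h0 : lpNorm (b 0) 2 μ ≤ D)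
    (hn : ∀ n : ℕ, lpNorm (b (n + 1)) 2 μ ≤ A * ((n : ℝ) + 1) ^ (-(γ / 2))) (n : ℕ) :
    ∑ i ∈ Finset.range (n + 1), lpNorm (b i) 2 μ ^ 2
      ≤ (D ^ 2 + A ^ 2 / (1 - γ)) * ((n : ℝ) + 1) ^ γ := by
  obtain ⟨hγ0, hγ2⟩ := hγ
  have h1γ : 0 < 1 - γ := by linarith
  have hx1 : (1 : ℝ) ≤ ((n : ℝ) + 1) ^ γ :=
    Real.one_le_rpow (by linarith [n.cast_nonneg (α := ℝ)]) (by linarith)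
  have hi : ∀ i ∈ Finset.range n, lpNorm (b (i + 1)) 2 μ ^ 2
      ≤ A ^ 2 * ((i : ℝ) + 1) ^ ((1 - γ) - 1) := by
    intro i _
    calc lpNorm (b (i + 1)) 2 μ ^ 2 ≤ (A * ((i : ℝ) + 1) ^ (-(γ / 2))) ^ 2 :=
          pow_le_pow_left₀ lpNorm_nonneg (hn i) 2
      _ = _ := by
          rw [mul_pow, ← Real.rpow_natCast (((i : ℝ) + 1) ^ (-(γ / 2))),
            ← Real.rpow_mul (by positivity)]
          congr 2
          push_cast
          ring
  have hs := sum_rpow_sub_one_le h1γ (by linarith) n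
  have h2 : (n : ℝ) ^ (1 - γ) ≤ ((n : ℝ) + 1) ^ γ :=
    (Real.rpow_le_rpow n.cast_nonneg (by linarith) h1γ.le).trans
      (Real.rpow_le_rpow_of_exponent_le (by linarith [n.cast_nonneg (α := ℝ)]) (by linarith))
  rw [Finset.sum_range_succ']
  have h3 : ∑ i ∈ Finset.range n, lpNorm (b (i + 1)) 2 μ ^ 2
      ≤ A ^ 2 / (1 - γ) * ((n : ℝ) + 1) ^ γ := by
    refine (Finset.sum_le_sum hi).trans ?_
    rw [← Finset.mul_sum]
    calc A ^ 2 * ∑ i ∈ Finset.range n, ((i : ℝ) + 1) ^ ((1 - γ) - 1)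
        ≤ A ^ 2 * (((n : ℝ) + 1) ^ γ / (1 - γ)) := by
          gcongr
          exact hs.trans (by gcongr)
      _ = _ := by ring
  have h4 : lpNorm (b 0) 2 μ ^ 2 ≤ D ^ 2 * ((n : ℝ) + 1) ^ γ := by
    calc lpNorm (b 0) 2 μ ^ 2 ≤ D ^ 2 * 1 := by
          rw [mul_one]
          exact pow_le_pow_left₀ lpNorm_nonneg h0 2
      _ ≤ _ := by gcongr
  linarith

end Sums

lemma average_succ_sub {Ω : Type*} (θ : ℕ → Ω → Param p) (θs : Param p) (n : ℕ) (ω : Ω) :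
    average θ (n + 1) ω - θs
      = ((n : ℝ) + 1)⁻¹ • ∑ i ∈ Finset.range (n + 1), (θ (i + 1) ω - θs) := by
  have h1 : ∀ m : ℕ, ∑ i ∈ Finset.Icc 1 m, θ i ω = ∑ i ∈ Finset.range m, θ (i + 1) ω := by
    intro m
    induction m with
    | zero => simp
    | succ m ih => rw [Finset.sum_Icc_succ_top (by omega), ih, Finset.sum_range_succ]
  have hn : (n : ℝ) + 1 ≠ 0 := by positivity
  rw [average, h1, Finset.sum_sub_distrib, Finset.sum_const, Finset.card_range, smul_sub,
    ← Nat.cast_smul_eq_nsmul ℝ, smul_smul]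
  push_cast
  rw [inv_mul_cancel₀ hn, one_smul]

namespace IsImplicitSGD

variable {Θ : Set (Param p)} {f : ℝ → Y → ℝ} {P : Measure (Param p × Y)} [IsProbabilityMeasure P]
  {θs : Param p} {S : Matrix (Fin p) (Fin p) ℝ} {lam0 lam2 lamf φ γ1 γ : ℝ}
  {Ω : Type*} {mΩ : MeasurableSpace Ω} {μ : Measure Ω} [IsProbabilityMeasure μ]
  {ℱ : Filtration ℕ mΩ} {ξ : ℕ → Ω → Param p × Y} {θ : ℕ → Ω → Param p}

lemma memLp_average_sub (hA : Assumptions Θ f P θs S lam0 lam2 lamf φ)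
    (hS : IsImplicitSGD Θ f P γ1 γ μ ℱ ξ θ) (n : ℕ) :
    MemLp (fun ω => average θ (n + 1) ω - θs) 2 μ := by
  have e : (fun ω => average θ (n + 1) ω - θs) = ((n : ℝ) + 1)⁻¹ •
      fun ω => ∑ i ∈ Finset.range (n + 1), (θ (i + 1) ω - θs) := by
    funext ω
    exact average_succ_sub θ θs n ω
  rw [e]
  exact (memLp_finsetSum _ fun i _ => hS.memLp_iterate_sub hA (i + 1)).const_smul _

/-- From the fourth moment to the second one, and to the `L²` norm of the squared error. -/
lemma lpNorm_iterate_le (hA : Assumptions Θ f P θs S lam0 lam2 lamf φ)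
    (hS : IsImplicitSGD Θ f P γ1 γ μ ℱ ξ θ) {A : ℝ} (hA0 : 0 ≤ A)
    (h4 : ∀ n, 1 ≤ n → ∫ ω, ‖θ n ω - θs‖ ^ 4 ∂μ ≤ A * (n : ℝ) ^ (-(2 * γ))) (n : ℕ) :
    MemLp (fun ω => ‖θ (n + 1) ω - θs‖ ^ 2) 2 μ ∧
    lpNorm (fun ω => ‖θ (n + 1) ω - θs‖ ^ 2) 2 μ ≤ √A * ((n : ℝ) + 1) ^ (-γ) ∧
    lpNorm (fun ω => θ (n + 1) ω - θs) 2 μ ≤ √(√A) * ((n : ℝ) + 1) ^ (-(γ / 2)) := by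
  have hm : Measurable fun ω => θ (n + 1) ω - θs := (hS.measurable_iterate _).sub_const θs
  have hL : MemLp (fun ω => ‖θ (n + 1) ω - θs‖ ^ 2) 2 μ := by
    refine .of_bound (hm.norm.pow_const 2).aestronglyMeasurable ((2 * |lam0| / lamf) ^ 2) ?_
    filter_upwards [hS.ae_norm_sub_le hA (n + 1)] with ω hω
    rw [Real.norm_of_nonneg (by positivity)]
    gcongr
  have hn : (0 : ℝ) < (n : ℝ) + 1 := by positivity
  have h2 : lpNorm (fun ω => ‖θ (n + 1) ω - θs‖ ^ 2) 2 μ ≤ √A * ((n : ℝ) + 1) ^ (-γ) := by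
    rw [lpNorm_two_eq_sqrt hL.1]
    have e : ∀ ω, ‖‖θ (n + 1) ω - θs‖ ^ 2‖ ^ 2 = ‖θ (n + 1) ω - θs‖ ^ 4 := fun ω => by
      rw [Real.norm_of_nonneg (by positivity)]
      ring
    simp only [e]
    have := h4 (n + 1) (by omega)
    push_cast at this
    refine (Real.sqrt_le_sqrt this).trans_eq ?_
    rw [Real.sqrt_mul hA0, show (-(2 * γ)) = -γ + -γ by ring, Real.rpow_add hn,
      Real.sqrt_mul_self (by positivity)]
  refine ⟨hL, h2, ?_⟩
  refine le_of_sq_le_sq ?_ (by positivity)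
  refine (sq_lpNorm_two_le_lpNorm_norm_sq hm.aestronglyMeasurable hL).trans (h2.trans_eq ?_)
  rw [mul_pow, Real.sq_sqrt (Real.sqrt_nonneg _), sq, ← Real.rpow_add hn]
  congr 2
  ring

end IsImplicitSGD

/-! ### The error of the averaged iterates -/

namespace IsImplicitSGD

variable {Θ : Set (Param p)} {f : ℝ → Y → ℝ} {P : Measure (Param p × Y)} [IsProbabilityMeasure P]
  {θs : Param p} {S : Matrix (Fin p) (Fin p) ℝ} {lam0 lam2 lamf φ γ1 γ : ℝ}
  {Ω : Type*} {mΩ : MeasurableSpace Ω} {μ : Measure Ω} [IsProbabilityMeasure μ]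
  {ℱ : Filtration ℕ mΩ} {ξ : ℕ → Ω → Param p × Y} {θ : ℕ → Ω → Param p}

/-- A sum of i.i.d. centered vectors. -/
lemma lpNorm_sum_centered_le (hS : IsImplicitSGD Θ f P γ1 γ μ ℱ ξ θ)
    {v : Param p × Y → Param p} (hv : Measurable v) (hv2 : MemLp v 2 P)
    (hmean : ∫ z, v z ∂P = 0) {τ : ℝ} (hτ : ∫ z, ‖v z‖ ^ 2 ∂P ≤ τ) (n : ℕ) :
    lpNorm (fun ω => ∑ i ∈ Finset.range n, v (ξ (i + 1) ω)) 2 μ ≤ √n * √τ := by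
  have hL2 : ∀ n, MemLp (fun ω => v (ξ (n + 1) ω)) 2 μ := by
    intro n
    have h : MemLp v 2 (μ.map (ξ (n + 1))) := by rwa [hS.data_law n]
    exact h.comp_of_map (hS.measurable_data n).aemeasurable
  have h := hS.integral_norm_sq_sum (T := fun _ z => v z) (hv.comp measurable_snd) hL2
    (fun u t => by
      rw [integral_inner (hv2.integrable (by norm_num)), hmean, inner_zero_right]) n
  rw [lpNorm_two_eq_sqrt (memLp_finsetSum _ fun i _ => hL2 i).1, h,
    ← Real.sqrt_mul n.cast_nonneg]
  apply Real.sqrt_le_sqrt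
  have hi : ∀ i ∈ Finset.range n, ∫ ω, ‖v (ξ (i + 1) ω)‖ ^ 2 ∂μ ≤ τ := by
    intro i _
    rw [← hS.data_law i, integral_map (hS.measurable_data i).aemeasurable
      (hv.norm.pow_const 2).aestronglyMeasurable] at hτ
    exact hτ
  refine (Finset.sum_le_sum hi).trans ?_
  simp

/-- Centered random operators applied to the current error: the sum has only the square root of
the size which the triangle inequality would give. -/
lemma lpNorm_sum_clm_apply_le (hA : Assumptions Θ f P θs S lam0 lam2 lamf φ)
    (hS : IsImplicitSGD Θ f P γ1 γ μ ℱ ξ θ)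
    {M : Param p × Y → Param p →L[ℝ] Param p} (hM : StronglyMeasurable M) {κ : ℝ} (hκ : 0 ≤ κ)
    (hbd : ∀ᵐ z ∂P, ‖M z‖ ≤ κ) (hmean : ∫ z, M z ∂P = 0) (n : ℕ) :
    lpNorm (fun ω => ∑ i ∈ Finset.range n, M (ξ (i + 1) ω) (θ i ω - θs)) 2 μ
      ≤ κ * √(∑ i ∈ Finset.range n, lpNorm (fun ω => θ i ω - θs) 2 μ ^ 2) := by
  have hMi : Integrable M P := .of_bound hM.aestronglyMeasurable κ hbd
  have hT : Measurable (Function.uncurry fun (t : Param p) z => M z (t - θs)) := by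
    have h1 : StronglyMeasurable fun w : Param p × (Param p × Y) => (M w.2, w.1 - θs) :=
      (hM.comp_measurable measurable_snd).prodMk (measurable_fst.sub_const θs).stronglyMeasurable
    exact (isBoundedBilinearMap_apply.continuous.comp_stronglyMeasurable h1).measurable
  have hle : ∀ n, ∀ᵐ ω ∂μ, ‖M (ξ (n + 1) ω) (θ n ω - θs)‖ ≤ κ * ‖θ n ω - θs‖ := by
    intro n
    filter_upwards [hS.ae_data hbd n] with ω hω
    exact (M _).le_of_opNorm_le hω _
  have hmeas : ∀ n, Measurable fun ω => M (ξ (n + 1) ω) (θ n ω - θs) := fun n =>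
    hT.comp ((hS.measurable_iterate n).prodMk (hS.measurable_data n))
  have hL2 : ∀ n, MemLp (fun ω => M (ξ (n + 1) ω) (θ n ω - θs)) 2 μ := fun n =>
    (hS.memLp_iterate_sub hA n).of_le_mul (hmeas n).aestronglyMeasurable (hle n)
  have h := hS.integral_norm_sq_sum hT hL2
    (fun u t => by
      rw [integral_inner (hMi.apply_continuousLinearMap _),
        ← ContinuousLinearMap.integral_apply hMi, hmean]
      simp) n
  rw [lpNorm_two_eq_sqrt (memLp_finsetSum _ fun i _ => hL2 i).1, h]
  conv_rhs => rw [← Real.sqrt_sq hκ, ← Real.sqrt_mul (sq_nonneg κ)]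
  apply Real.sqrt_le_sqrt
  rw [Finset.mul_sum]
  refine Finset.sum_le_sum fun i _ => ?_
  have hb := hS.memLp_iterate_sub hA i
  rw [lpNorm_two_eq_sqrt hb.1, Real.sq_sqrt (by positivity), ← integral_const_mul]
  refine integral_mono_ae ((hL2 i).integrable_norm_pow (by simp))
    ((hb.integrable_norm_pow (by simp)).const_mul _) ?_
  filter_upwards [hle i] with ω hω
  rw [← mul_pow]
  exact pow_le_pow_left₀ (norm_nonneg _) hω 2

end IsImplicitSGD

/-- A sum of terms which are of the order of the learning rate in `L²` is of order `n^{1-γ}`. -/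
lemma lpNorm_sum_le_of_ae_le {Ω E : Type*} {mΩ : MeasurableSpace Ω} {μ : Measure Ω}
    [IsProbabilityMeasure μ] [NormedAddCommGroup E] {e : ℕ → Ω → E} {x : ℕ → Ω → ℝ}
    {γ1 γ k l A : ℝ} (hγ1 : 0 < γ1) (hγ : γ ∈ Set.Ioo (1 / 2 : ℝ) 1) (hk : 0 ≤ k) (hl : 0 ≤ l)
    (hA : 0 ≤ A) (he : ∀ n, AEStronglyMeasurable (e n) μ) (hx : ∀ n, MemLp (x n) 2 μ)
    (hxA : ∀ n : ℕ, lpNorm (x n) 2 μ ≤ A * ((n : ℝ) + 1) ^ (-γ))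
    (hle : ∀ n, ∀ᵐ ω ∂μ, ‖e n ω‖ ≤ k * rate γ1 γ (n + 1) + l * x n ω) :
    (∀ n, MemLp (e n) 2 μ) ∧
    ∀ n : ℕ, lpNorm (fun ω => ∑ i ∈ Finset.range (n + 1), e i ω) 2 μ
      ≤ (k * γ1 + l * A) / (1 - γ) * ((n : ℝ) + 1) ^ (1 - γ) := by
  have hbdL : ∀ i, MemLp (fun ω => k * rate γ1 γ (i + 1) + l * x i ω) 2 μ := by
    intro i
    have h1 : MemLp (fun _ : Ω => k * rate γ1 γ (i + 1)) 2 μ := memLp_const _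
    exact h1.add ((hx i).const_mul l)
  have heL : ∀ i, MemLp (e i) 2 μ := fun i => (hbdL i).mono' (he i) (hle i)
  refine ⟨heL, fun n => ?_⟩
  have hei : ∀ i ∈ Finset.range (n + 1), lpNorm (e i) 2 μ
      ≤ (k * γ1 + l * A) * ((i : ℝ) + 1) ^ ((1 - γ) - 1) := by
    intro i _
    have hr : 0 < rate γ1 γ (i + 1) := rate_succ_pos γ hγ1 i
    have a0 := lpNorm_two_le_of_ae_le (he i) (hbdL i) (hle i)
    have a1 : lpNorm (fun _ : Ω => k * rate γ1 γ (i + 1)) 2 μ ≤ k * rate γ1 γ (i + 1) := by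
      rw [lpNorm_const (by simp) (IsProbabilityMeasure.ne_zero μ),
        Real.norm_of_nonneg (by positivity)]
      simp
    have a2 : lpNorm (l • x i) 2 μ ≤ l * (A * ((i : ℝ) + 1) ^ (-γ)) := by
      rw [lpNorm_const_smul, coe_nnnorm, Real.norm_of_nonneg hl]
      exact mul_le_mul_of_nonneg_left (hxA i) hl
    have a3 : lpNorm (fun ω => k * rate γ1 γ (i + 1) + l * x i ω) 2 μ
        ≤ lpNorm (fun _ : Ω => k * rate γ1 γ (i + 1)) 2 μ + lpNorm (l • x i) 2 μ :=
      lpNorm_add_le (memLp_const (k * rate γ1 γ (i + 1))) (by norm_num)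
    refine (a0.trans (a3.trans (add_le_add a1 a2))).trans_eq ?_
    rw [rate_succ, show (1 - γ) - 1 = -γ by ring]
    ring
  have hsum := lpNorm_sum_le (s := Finset.range (n + 1)) (fun i _ => heL i) (p := 2)
    (by norm_num)
  rw [Finset.sum_fn] at hsum
  refine hsum.trans ((Finset.sum_le_sum hei).trans ?_)
  rw [← Finset.mul_sum]
  have hb := sum_rpow_sub_one_le (s := 1 - γ) (by linarith [hγ.2]) (by linarith [hγ.1]) (n + 1)
  push_cast at hb
  refine (mul_le_mul_of_nonneg_left hb (by positivity)).trans_eq ?_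
  ring

lemma stronglyMeasurable_clm_apply {Ω : Type*} {mΩ : MeasurableSpace Ω}
    {B : Ω → Param p →L[ℝ] Param p} {x : Ω → Param p}
    (hB : StronglyMeasurable B) (hx : StronglyMeasurable x) :
    StronglyMeasurable fun ω => B ω (x ω) :=
  isBoundedBilinearMap_apply.continuous.comp_stronglyMeasurable (hB.prodMk hx)

/-- What is left of one step of the recursion, in terms of the old error `b` and the new error
`b'`, after it has been linearized at the target with gradient `w` and Hessian `M` at the new data
point and mean Hessian `H`; `c` is the inverse learning rate, so that `c • (b - b')` is the
gradient at the new iterate. -/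
def linearizationError {E : Type*} [NormedAddCommGroup E] [NormedSpace ℝ E]
    (H M : E →L[ℝ] E) (w : E) (c : ℝ) (b b' : E) : E :=
  (M - H) (b - b') - (c • (b - b') - w - M b')

/-- The linearization of the recursion at the target. The Hessian `M` at the new data point is
replaced by its mean `H`; the deviation is applied to the old error, which is independent of the
new data point, and the difference goes into the last term. -/
lemma error_decomposition {E : Type*} [NormedAddCommGroup E] [NormedSpace ℝ E]
    {H G M : E →L[ℝ] E} (hG : ∀ v, G (H v) = v) (c : ℝ) (w b b' : E) :
    b' = -G w + G (c • (b - b') - (M - H) b + linearizationError H M w c b b') := by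
  conv_lhs => rw [← hG b']
  simp only [linearizationError, sub_apply, map_sub, map_add]
  abel

namespace IsImplicitSGD

variable {Θ : Set (Param p)} {f : ℝ → Y → ℝ} {P : Measure (Param p × Y)}
  {θs : Param p} {S : Matrix (Fin p) (Fin p) ℝ} {lam0 lam2 lamf φ γ1 γ : ℝ}
  {Ω : Type*} {mΩ : MeasurableSpace Ω} {μ : Measure Ω}
  {ℱ : Filtration ℕ mΩ} {ξ : ℕ → Ω → Param p × Y} {θ : ℕ → Ω → Param p}
  {H : Param p →L[ℝ] Param p} {M : Param p × Y → Param p →L[ℝ] Param p}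
  {w : Param p × Y → Param p} {κ A : ℝ}

/-- The gradient step is the increment of the errors. -/
lemma ae_error_sub_eq (hS : IsImplicitSGD Θ f P γ1 γ μ ℱ ξ θ) (n : ℕ) :
    ∀ᵐ ω ∂μ, (θ n ω - θs) - (θ (n + 1) ω - θs)
      = rate γ1 γ (n + 1) • lossGrad f (θ (n + 1) ω) (ξ (n + 1) ω) := by
  filter_upwards [hS.update n] with ω h1
  rw [sub_sub_sub_cancel_right]
  exact sub_eq_iff_eq_add'.2 (eq_sub_iff_add_eq.1 h1).symm

lemma stronglyMeasurable_error (hS : IsImplicitSGD Θ f P γ1 γ μ ℱ ξ θ) (n : ℕ) :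
    StronglyMeasurable fun ω => θ n ω - θs :=
  ((hS.measurable_iterate n).sub_const θs).stronglyMeasurable

lemma stronglyMeasurable_linearizationError (hS : IsImplicitSGD Θ f P γ1 γ μ ℱ ξ θ)
    (hM : StronglyMeasurable M) (hw : StronglyMeasurable w) (c : ℝ) (n : ℕ) :
    StronglyMeasurable fun ω => linearizationError H (M (ξ (n + 1) ω)) (w (ξ (n + 1) ω)) c
      (θ n ω - θs) (θ (n + 1) ω - θs) := by
  have hmt := fun i => hS.stronglyMeasurable_error (θs := θs) i
  have hmM : StronglyMeasurable fun ω => M (ξ (n + 1) ω) :=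
    hM.comp_measurable (hS.measurable_data n)
  exact (stronglyMeasurable_clm_apply (hmM.sub stronglyMeasurable_const)
      ((hmt n).sub (hmt (n + 1)))).sub
    (((((hmt n).sub (hmt (n + 1))).const_smul c).sub
      (hw.comp_measurable (hS.measurable_data n))).sub
        (stronglyMeasurable_clm_apply hmM (hmt (n + 1))))

lemma ae_norm_linearizationError_le (hA : Assumptions Θ f P θs S lam0 lam2 lamf φ)
    (hS : IsImplicitSGD Θ f P γ1 γ μ ℱ ξ θ) (hγ1 : 0 < γ1)
    (hwae : lossGrad f θs =ᵐ[P] w)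
    (hMae : (fun z => hessianOp (fun t => loss f t z) θs) =ᵐ[P] M)
    (hκ : 0 ≤ κ) (hdev : ∀ᵐ z ∂P, ‖M z - H‖ ≤ κ) (n : ℕ) :
    ∀ᵐ ω ∂μ, ‖linearizationError H (M (ξ (n + 1) ω)) (w (ξ (n + 1) ω))
        (rate γ1 γ (n + 1))⁻¹ (θ n ω - θs) (θ (n + 1) ω - θs)‖
      ≤ κ * |lam0| * rate γ1 γ (n + 1) + |lam2| * ‖θ (n + 1) ω - θs‖ ^ 2 := by
  filter_upwards [hS.ae_error_sub_eq (θs := θs) n, hS.mem_space (n + 1),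
    hS.ae_data hA.ae_isRegularDatum n, hS.ae_data hdev n, hS.ae_data hwae n,
    hS.ae_data hMae n] with ω hg h2 h3 h4 h5 h6
  have hr : 0 < rate γ1 γ (n + 1) := rate_succ_pos γ hγ1 n
  have hgb := h3.norm_lossGrad_le hA.convex_space hA.target_interior h2
  have hT := h3.norm_lossGrad_sub_sub_le hA.convex_space hA.target_mem h2
  rw [h5, h6] at hT
  rw [linearizationError, hg, smul_smul, inv_mul_cancel₀ hr.ne', one_smul]
  refine (norm_sub_le _ _).trans (add_le_add ?_ hT)
  refine ((M _ - H).le_of_opNorm_le h4 _).trans ?_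
  rw [norm_smul, Real.norm_of_nonneg hr.le, mul_comm (rate γ1 γ (n + 1)), mul_assoc]
  gcongr

/-- The linearization errors are of second order, the learning rate counted as the square of the
error; their sum is of order `n^{1-γ}`. -/
lemma lpNorm_sum_linearizationError_le [IsProbabilityMeasure μ]
    (hA : Assumptions Θ f P θs S lam0 lam2 lamf φ)
    (hS : IsImplicitSGD Θ f P γ1 γ μ ℱ ξ θ) (hγ1 : 0 < γ1) (hγ : γ ∈ Set.Ioo (1 / 2 : ℝ) 1)
    (hM : StronglyMeasurable M) (hw : StronglyMeasurable w)
    (hwae : lossGrad f θs =ᵐ[P] w)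
    (hMae : (fun z => hessianOp (fun t => loss f t z) θs) =ᵐ[P] M)
    (hκ : 0 ≤ κ) (hdev : ∀ᵐ z ∂P, ‖M z - H‖ ≤ κ) (hA0 : 0 ≤ A)
    (hsq : ∀ n, MemLp (fun ω => ‖θ (n + 1) ω - θs‖ ^ 2) 2 μ ∧
      lpNorm (fun ω => ‖θ (n + 1) ω - θs‖ ^ 2) 2 μ ≤ A * ((n : ℝ) + 1) ^ (-γ)) :
    (∀ n, MemLp (fun ω => linearizationError H (M (ξ (n + 1) ω)) (w (ξ (n + 1) ω))
        (rate γ1 γ (n + 1))⁻¹ (θ n ω - θs) (θ (n + 1) ω - θs)) 2 μ) ∧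
    ∀ n : ℕ, lpNorm (fun ω => ∑ i ∈ Finset.range (n + 1), linearizationError H
        (M (ξ (i + 1) ω)) (w (ξ (i + 1) ω)) (rate γ1 γ (i + 1))⁻¹ (θ i ω - θs)
        (θ (i + 1) ω - θs)) 2 μ
      ≤ (κ * |lam0| * γ1 + |lam2| * A) / (1 - γ) * ((n : ℝ) + 1) ^ (1 - γ) :=
  lpNorm_sum_le_of_ae_le
    (e := fun n ω => linearizationError H (M (ξ (n + 1) ω)) (w (ξ (n + 1) ω))
      (rate γ1 γ (n + 1))⁻¹ (θ n ω - θs) (θ (n + 1) ω - θs))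
    (x := fun n ω => ‖θ (n + 1) ω - θs‖ ^ 2) hγ1 hγ (by positivity) (abs_nonneg _) hA0
    (fun n => (hS.stronglyMeasurable_linearizationError hM hw _ n).aestronglyMeasurable)
    (fun n => (hsq n).1) (fun n => (hsq n).2)
    (hS.ae_norm_linearizationError_le hA hγ1 hwae hMae hκ hdev)

end IsImplicitSGD

/-- The triangle inequality for the decomposition of the averaged error. -/
lemma lpNorm_inv_smul_decomposition_le {Ω E : Type*} {mΩ : MeasurableSpace Ω} {μ : Measure Ω}
    [NormedAddCommGroup E] [NormedSpace ℝ E] (G : E →L[ℝ] E) {s₁ s₂ s₃ s₄ : Ω → E}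
    (h1 : MemLp s₁ 2 μ) (h2 : MemLp s₂ 2 μ) (h3 : MemLp s₃ 2 μ) (h4 : MemLp s₄ 2 μ)
    {a : ℝ} (ha : 0 ≤ a) :
    lpNorm (fun ω => a • (-s₁ ω + G (s₂ ω - s₃ ω + s₄ ω))) 2 μ
      ≤ a * (lpNorm s₁ 2 μ + ‖G‖ * (lpNorm s₂ 2 μ + lpNorm s₃ 2 μ + lpNorm s₄ 2 μ)) := by
  have hL : MemLp (s₂ - s₃ + s₄) 2 μ := (h2.sub h3).add h4
  have hG : lpNorm (fun ω => G ((s₂ - s₃ + s₄) ω)) 2 μ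
      ≤ ‖G‖ * (lpNorm s₂ 2 μ + lpNorm s₃ 2 μ + lpNorm s₄ 2 μ) := by
    have hle := lpNorm_two_le_of_ae_le (G.comp_memLp' hL).1 (hL.norm.const_mul ‖G‖)
      (Eventually.of_forall fun ω => G.le_opNorm _)
    refine hle.trans ?_
    have := lpNorm_const_smul ‖G‖ (fun ω => ‖(s₂ - s₃ + s₄) ω‖) μ (p := 2)
    rw [coe_nnnorm, norm_norm] at this
    refine (le_of_eq this).trans ?_
    rw [lpNorm_norm hL.1]
    gcongr
    refine (lpNorm_add_le (h2.sub h3) (by norm_num)).trans ?_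
    gcongr
    exact lpNorm_sub_le h2 (by norm_num)
  have he : (fun ω => a • (-s₁ ω + G (s₂ ω - s₃ ω + s₄ ω)))
      = a • (-s₁ + fun ω => G ((s₂ - s₃ + s₄) ω)) := rfl
  rw [he, lpNorm_const_smul, coe_nnnorm, Real.norm_of_nonneg ha]
  refine mul_le_mul_of_nonneg_left ?_ ha
  refine (lpNorm_add_le h1.neg (by norm_num)).trans ?_
  rw [lpNorm_neg]
  gcongr

/-- The factor `1/n` turns the orders of the sums into the orders of the error bound. -/
lemma inv_mul_orders_eq {N : ℝ} (hN : 0 < N) (γ t a b : ℝ) :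
    N⁻¹ * (√N * t + (a * N ^ (γ / 2) + b * N ^ (1 - γ)))
      = N ^ (-(1 / 2) : ℝ) * t + a * N ^ (-1 + γ / 2) + b * N ^ (-γ) := by
  have p1 : N⁻¹ * √N = N ^ (-(1 / 2) : ℝ) := by
    rw [Real.sqrt_eq_rpow, ← Real.rpow_neg_one, ← Real.rpow_add hN]
    norm_num
  have p2 : N ^ (-1 + γ / 2) = N⁻¹ * N ^ (γ / 2) := by
    rw [Real.rpow_add hN, Real.rpow_neg_one]
  have p3 : N ^ (-γ) = N⁻¹ * N ^ (1 - γ) := by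
    rw [← Real.rpow_neg_one, ← Real.rpow_add hN]
    congr 1
    ring
  rw [← p1, p2, p3]
  ring

namespace IsImplicitSGD

variable {Θ : Set (Param p)} {f : ℝ → Y → ℝ} {P : Measure (Param p × Y)} [IsProbabilityMeasure P]
  {θs : Param p} {S : Matrix (Fin p) (Fin p) ℝ} {lam0 lam2 lamf φ γ1 γ : ℝ}
  {Ω : Type*} {mΩ : MeasurableSpace Ω} {μ : Measure Ω} [IsProbabilityMeasure μ]
  {ℱ : Filtration ℕ mΩ} {ξ : ℕ → Ω → Param p × Y} {θ : ℕ → Ω → Param p}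
  {H G : Param p →L[ℝ] Param p} {M : Param p × Y → Param p →L[ℝ] Param p}
  {w : Param p × Y → Param p} {κ A τ : ℝ}

/-- The error of the averaged iterates in terms of everywhere measurable versions `w` and `M` of
the gradient and the Hessian at the target, the mean `H` of `M` and its left inverse `G`. -/
lemma lpNorm_average_sub_le (hA : Assumptions Θ f P θs S lam0 lam2 lamf φ)
    (hS : IsImplicitSGD Θ f P γ1 γ μ ℱ ξ θ) (hγ1 : 0 < γ1) (hγ : γ ∈ Set.Ioo (1 / 2 : ℝ) 1)
    (hM : StronglyMeasurable M) (hw : StronglyMeasurable w)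
    (hwae : lossGrad f θs =ᵐ[P] w)
    (hMae : (fun z => hessianOp (fun t => loss f t z) θs) =ᵐ[P] M)
    (hκ : 0 ≤ κ) (hdev : ∀ᵐ z ∂P, ‖M z - H‖ ≤ κ) (hdev0 : ∫ z, (M z - H) ∂P = 0)
    (hG : ∀ v, G (H v) = v) (hGw : ∫ z, G (w z) ∂P = 0) (hτ : ∫ z, ‖G (w z)‖ ^ 2 ∂P ≤ τ)
    (hA0 : 0 ≤ A)
    (h4 : ∀ n, 1 ≤ n → ∫ ω, ‖θ n ω - θs‖ ^ 4 ∂μ ≤ A * (n : ℝ) ^ (-(2 * γ))) (n : ℕ) :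
    lpNorm (fun ω => average θ (n + 1) ω - θs) 2 μ
      ≤ ((n : ℝ) + 1) ^ (-(1 / 2) : ℝ) * √τ
        + ‖G‖ * (γ1⁻¹ * (2 * |lam0| / lamf + √(√A) + 2 * √(√A) / γ)
            + κ * √((2 * |lam0| / lamf) ^ 2 + √(√A) ^ 2 / (1 - γ)))
          * ((n : ℝ) + 1) ^ (-1 + γ / 2)
        + ‖G‖ * ((κ * |lam0| * γ1 + |lam2| * √A) / (1 - γ)) * ((n : ℝ) + 1) ^ (-γ) := by
  have hn : (0 : ℝ) < (n : ℝ) + 1 := by positivity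
  have hlf := hA.lamf_pos
  have hit := hS.lpNorm_iterate_le hA hA0 h4
  have hb := hS.memLp_iterate_sub hA
  have hb0 : lpNorm (fun ω => θ 0 ω - θs) 2 μ ≤ 2 * |lam0| / lamf :=
    lpNorm_two_le_of_ae_le_const (by positivity) (hb 0).1 (hS.ae_norm_sub_le hA 0)
  have hGwL : MemLp (fun z => G (w z)) 2 P :=
    G.comp_memLp' ((hA.memLp_lossGrad hA.target_mem).ae_eq hwae)
  obtain ⟨heL, b4⟩ := hS.lpNorm_sum_linearizationError_le hA hγ1 hγ hM hw hwae hMae hκ hdev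
    (Real.sqrt_nonneg A) (fun n => ⟨(hit n).1, (hit n).2.1⟩)
  have b1 := hS.lpNorm_sum_centered_le (v := fun z => G (w z))
    (G.continuous.measurable.comp hw.measurable) hGwL hGw hτ (n + 1)
  have b2 := lpNorm_sum_inv_rate_smul_sub_le (b := fun i ω => θ i ω - θs) hγ1 hγ
    (Real.sqrt_nonneg _) hb hb0 (fun i => (hit i).2.2) n
  have b3 := (hS.lpNorm_sum_clm_apply_le hA (M := fun z => M z - H)
    (hM.sub stronglyMeasurable_const) hκ hdev hdev0 (n + 1)).trans
    (mul_le_mul_of_nonneg_left (Real.sqrt_le_sqrt (sum_lpNorm_sq_le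
      (b := fun i ω => θ i ω - θs) hγ hb0 (fun i => (hit i).2.2) n)) hκ)
  have h1L : MemLp (fun ω => ∑ i ∈ Finset.range (n + 1), G (w (ξ (i + 1) ω))) 2 μ := by
    refine memLp_finsetSum _ fun i _ => ?_
    have h : MemLp (fun z => G (w z)) 2 (μ.map (ξ (i + 1))) := by rwa [hS.data_law i]
    exact h.comp_of_map (hS.measurable_data i).aemeasurable
  have h2L : MemLp (fun ω => ∑ i ∈ Finset.range (n + 1), (rate γ1 γ (i + 1))⁻¹ •
      ((θ i ω - θs) - (θ (i + 1) ω - θs))) 2 μ :=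
    memLp_finsetSum _ fun i _ => ((hb i).sub (hb (i + 1))).const_smul (rate γ1 γ (i + 1))⁻¹
  have h3L : MemLp (fun ω => ∑ i ∈ Finset.range (n + 1),
      (M (ξ (i + 1) ω) - H) (θ i ω - θs)) 2 μ := by
    refine memLp_finsetSum _ fun i _ => (hb i).of_le_mul (c := κ)
      (stronglyMeasurable_clm_apply ((hM.comp_measurable (hS.measurable_data i)).sub
        stronglyMeasurable_const) (hS.stronglyMeasurable_error i)).aestronglyMeasurable ?_
    filter_upwards [hS.ae_data hdev i] with ω hω
    exact (M _ - H).le_of_opNorm_le hω _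
  have htri := lpNorm_inv_smul_decomposition_le G h1L h2L h3L
    (memLp_finsetSum (Finset.range (n + 1)) fun i _ => heL i)
    (by positivity : 0 ≤ ((n : ℝ) + 1)⁻¹)
  have hdec : ∀ ω, average θ (n + 1) ω - θs = ((n : ℝ) + 1)⁻¹ •
      (-(∑ i ∈ Finset.range (n + 1), G (w (ξ (i + 1) ω)))
        + G ((∑ i ∈ Finset.range (n + 1), (rate γ1 γ (i + 1))⁻¹ •
            ((θ i ω - θs) - (θ (i + 1) ω - θs)))
          - (∑ i ∈ Finset.range (n + 1), (M (ξ (i + 1) ω) - H) (θ i ω - θs))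
          + ∑ i ∈ Finset.range (n + 1), linearizationError H (M (ξ (i + 1) ω))
              (w (ξ (i + 1) ω)) (rate γ1 γ (i + 1))⁻¹ (θ i ω - θs) (θ (i + 1) ω - θs))) := by
    intro ω
    rw [average_succ_sub, ← Finset.sum_sub_distrib, ← Finset.sum_add_distrib, map_sum,
      ← Finset.sum_neg_distrib, ← Finset.sum_add_distrib]
    congr 1
    exact Finset.sum_congr rfl fun i _ => error_decomposition hG _ _ _ _
  simp only [hdec]
  refine htri.trans ?_
  rw [← inv_mul_orders_eq hn]
  refine mul_le_mul_of_nonneg_left ?_ (by positivity)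
  push_cast at b1
  have hsplit : √(((2 * |lam0| / lamf) ^ 2 + √(√A) ^ 2 / (1 - γ)) * ((n : ℝ) + 1) ^ γ)
      = √((2 * |lam0| / lamf) ^ 2 + √(√A) ^ 2 / (1 - γ)) * ((n : ℝ) + 1) ^ (γ / 2) := by
    have h1γ : 0 < 1 - γ := by linarith [hγ.2]
    rw [Real.sqrt_mul (by positivity), Real.sqrt_eq_rpow (((n : ℝ) + 1) ^ γ),
      ← Real.rpow_mul hn.le]
    congr 2
    ring
  rw [hsplit] at b3
  have b234 := mul_le_mul_of_nonneg_left (add_le_add (add_le_add b2 b3) (b4 n)) (norm_nonneg G)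
  refine (add_le_add b1 b234).trans_eq ?_
  ring

end IsImplicitSGD

/-- The `L²` error of averaged implicit SGD, with constants that are uniform over all initial
conditions. Since `Θ` is bounded, no term for the initial error is needed. -/
lemma Assumptions.exists_lpNorm_average_sub_le {Θ : Set (Param p)} {f : ℝ → Y → ℝ}
    {P : Measure (Param p × Y)} [IsProbabilityMeasure P]
    {θs : Param p} {S : Matrix (Fin p) (Fin p) ℝ} {lam0 lam2 lamf φ γ1 γ : ℝ}
    (hA : Assumptions Θ f P θs S lam0 lam2 lamf φ) (hγ1 : 0 < γ1)
    (hγ : γ ∈ Set.Ioo (1 / 2 : ℝ) 1) :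
    ∃ C₁ C₂ : ℝ, ∀ {Ω : Type*} {mΩ : MeasurableSpace Ω} (μ : Measure Ω)
      [IsProbabilityMeasure μ] (ℱ : Filtration ℕ mΩ)
      (ξ : ℕ → Ω → Param p × Y) (θ : ℕ → Ω → Param p), IsImplicitSGD Θ f P γ1 γ μ ℱ ξ θ →
      ∀ n : ℕ, lpNorm (fun ω => average θ (n + 1) ω - θs) 2 μ
        ≤ leadingTerm (hessianMat (expectedLoss f P) θs) S (n + 1)
          + C₁ * ((n : ℝ) + 1) ^ (-1 + γ / 2) + C₂ * ((n : ℝ) + 1) ^ (-γ) := by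
  obtain ⟨A, hA0, hfour⟩ := hA.exists_fourth_moment_le hγ1 hγ
  obtain ⟨K, hK, hKb⟩ := hA.ae_norm_hessianOp_le hA.target_interior
  have hwm := hA.aestronglyMeasurable_lossGrad hA.target_mem
  have hMm := hA.aestronglyMeasurable_hessianOp hA.target_interior
  have hwae := hwm.ae_eq_mk
  have hMae := hMm.ae_eq_mk
  have hMsm := hMm.stronglyMeasurable_mk
  have hwsm := hwm.stronglyMeasurable_mk
  generalize hwm.mk _ = w at hwae hwsm
  generalize hMm.mk _ = M at hMae hMsm
  have hMint : Integrable M P := (hA.integrable_hessianOp hA.target_interior).congr hMae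
  have hHM : hessianOp (expectedLoss f P) θs = ∫ z, M z ∂P := by
    rw [hA.hessianOp_expectedLoss hA.target_interior]
    exact integral_congr_ae hMae
  have hMb : ∀ᵐ z ∂P, ‖M z‖ ≤ K := by
    filter_upwards [hKb, hMae] with z h1 h2
    rwa [← h2]
  have hHb : ‖hessianOp (expectedLoss f P) θs‖ ≤ K := by
    rw [hHM]
    simpa using norm_integral_le_of_norm_le_const hMb
  have hdev : ∀ᵐ z ∂P, ‖M z - hessianOp (expectedLoss f P) θs‖ ≤ 2 * K := by
    filter_upwards [hMb] with z hz
    exact (norm_sub_le _ _).trans (by linarith)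
  have hdev0 : ∫ z, (M z - hessianOp (expectedLoss f P) θs) ∂P = 0 := by
    rw [integral_sub hMint (integrable_const _), ← hHM]
    simp
  have hwL : MemLp w 2 P := (hA.memLp_lossGrad hA.target_mem).ae_eq hwae
  have hGw : ∫ z, Matrix.toEuclideanCLM (𝕜 := ℝ) (hessianMat (expectedLoss f P) θs)⁻¹ (w z) ∂P
      = 0 := by
    rw [ContinuousLinearMap.integral_comp_comm _ (hwL.integrable (by norm_num)),
      ← integral_congr_ae hwae, hA.integral_lossGrad_target, map_zero]
  have hτ : ∫ z, ‖Matrix.toEuclideanCLM (𝕜 := ℝ) (hessianMat (expectedLoss f P) θs)⁻¹ (w z)‖ ^ 2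
      ∂P ≤ ((hessianMat (expectedLoss f P) θs)⁻¹ * S
        * (hessianMat (expectedLoss f P) θs)⁻¹).trace := by
    refine le_trans (le_of_eq ?_) hA.integral_norm_sq_inv_hessian_lossGrad_le
    refine integral_congr_ae ?_
    filter_upwards [hwae] with z hz
    rw [hz]
  set G := Matrix.toEuclideanCLM (𝕜 := ℝ) (hessianMat (expectedLoss f P) θs)⁻¹
  refine ⟨‖G‖ * (γ1⁻¹ * (2 * |lam0| / lamf + √(√A) + 2 * √(√A) / γ)
      + 2 * K * √((2 * |lam0| / lamf) ^ 2 + √(√A) ^ 2 / (1 - γ))),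
    ‖G‖ * ((2 * K * |lam0| * γ1 + |lam2| * √A) / (1 - γ)),
    fun {Ω mΩ} μ _ ℱ ξ θ hS n => ?_⟩
  have h := hS.lpNorm_average_sub_le hA hγ1 hγ hMsm hwsm hwae hMae (by positivity) hdev hdev0
    hA.inv_hessianMat_apply hGw hτ hA0 (hfour μ ℱ ξ θ hS) n
  rw [leadingTerm]
  push_cast
  exact h

end AISGD

namespace AISGD

variable {p : ℕ} {Y : Type*}

/-! ### Correctly specified models -/

/-- The likelihood ratio `exp (-L(θ, ξ)) / exp (-L(θs, ξ))`. -/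
noncomputable def likelihoodRatio (f : ℝ → Y → ℝ) (θs θ : Param p) (ξ : Param p × Y) : ℝ :=
  Real.exp (loss f θs ξ - loss f θ ξ)

lemma likelihoodRatio_self (f : ℝ → Y → ℝ) (θs : Param p) (ξ : Param p × Y) :
    likelihoodRatio f θs θs ξ = 1 := by
  simp [likelihoodRatio]

lemma likelihoodRatio_pos (f : ℝ → Y → ℝ) (θs θ : Param p) (ξ : Param p × Y) :
    0 < likelihoodRatio f θs θ ξ :=
  Real.exp_pos _

lemma measurable_likelihoodRatio [MeasurableSpace Y] {f : ℝ → Y → ℝ} (hf : Measurable (Function.uncurry f))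
    (θs θ : Param p) : Measurable (likelihoodRatio f θs θ) :=
  ((measurable_loss_apply hf θs).sub (measurable_loss_apply hf θ)).exp

namespace WellSpecified

variable [MeasurableSpace Y] {f : ℝ → Y → ℝ} {P ν : Measure (Param p × Y)} {θs : Param p}

/-- Expectations under the law of the data as integrals against the reference measure. -/
lemma integral_eq (hW : WellSpecified f P θs ν) (hf : Measurable (Function.uncurry f))
    (g : Param p × Y → ℝ) : ∫ ξ, g ξ ∂P = ∫ ξ, g ξ * Real.exp (-loss f θs ξ) ∂ν := by
  have hm : Measurable fun ξ => ENNReal.ofReal (Real.exp (-loss f θs ξ)) :=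
    (measurable_loss_apply hf θs).neg.exp.ennreal_ofReal
  rw [hW.data_density, integral_withDensity_eq_integral_toReal_smul hm (by simp)]
  refine integral_congr_ae (Eventually.of_forall fun ξ => ?_)
  simp only [smul_eq_mul, ENNReal.toReal_ofReal (Real.exp_pos _).le]
  ring

lemma integral_likelihoodRatio (hW : WellSpecified f P θs ν)
    (hf : Measurable (Function.uncurry f)) :
    ∀ᶠ θ in 𝓝 θs, ∫ ξ, likelihoodRatio f θs θ ξ ∂P = 1 := by
  filter_upwards [hW.normalized] with θ hθ
  rw [hW.integral_eq hf, ← hθ]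
  refine integral_congr_ae (Eventually.of_forall fun ξ => ?_)
  simp only [likelihoodRatio]
  rw [← Real.exp_add]
  congr 1
  ring

lemma fisherInfo_apply (hW : WellSpecified f P θs ν) (hf : Measurable (Function.uncurry f))
    (i j : Fin p) :
    fisherInfo f ν θs i j = ∫ ξ, lossGrad f θs ξ i * lossGrad f θs ξ j ∂P := by
  rw [hW.integral_eq hf]
  simp [fisherInfo]

end WellSpecified

namespace IsRegularDatum

variable {Θ : Set (Param p)} {f : ℝ → Y → ℝ} {lam0 lam2 : ℝ} {ξ : Param p × Y}

lemma hasFDerivAt_likelihoodRatio (h : IsRegularDatum Θ f lam0 lam2 ξ) (θs : Param p)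
    {θ : Param p} (hθ : θ ∈ Θ) :
    HasFDerivAt (fun t => likelihoodRatio f θs t ξ)
      (innerSL ℝ (-(likelihoodRatio f θs θ ξ • lossGrad f θ ξ))) θ := by
  have h1 := ((h.diff θ hθ).hasGradientAt.hasFDerivAt.const_sub (loss f θs ξ)).exp
  refine h1.congr_fderiv ?_
  ext v
  simp [likelihoodRatio, lossGrad]

lemma likelihoodRatio_le (h : IsRegularDatum Θ f lam0 lam2 ξ) {θs θ : Param p} {r : ℝ}
    (hs : θs ∈ Θ) (hθ : θ ∈ Θ) (hr : ‖θ - θs‖ ≤ r) :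
    likelihoodRatio f θs θ ξ ≤ Real.exp (|lam0| * r) := by
  refine Real.exp_le_exp.2 ((le_abs_self _).trans ((h.lip θs hs θ hθ).trans ?_))
  rw [norm_sub_rev]
  calc lam0 * ‖θ - θs‖ ≤ |lam0| * ‖θ - θs‖ := by gcongr; exact le_abs_self _
    _ ≤ _ := by gcongr

lemma abs_likelihoodRatio_sub_le (h : IsRegularDatum Θ f lam0 lam2 ξ) (hΘ : Convex ℝ Θ)
    {θs : Param p} {r : ℝ} (hs : θs ∈ interior Θ) (hball : Metric.closedBall θs r ⊆ Θ)
    {t₁ t₂ : Param p} (h1 : t₁ ∈ Metric.closedBall θs r) (h2 : t₂ ∈ Metric.closedBall θs r) :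
    |likelihoodRatio f θs t₁ ξ - likelihoodRatio f θs t₂ ξ|
      ≤ Real.exp (|lam0| * r) * |lam0| * ‖t₁ - t₂‖ := by
  refine Convex.norm_image_sub_le_of_norm_hasFDerivWithin_le (𝕜 := ℝ)
    (fun t ht => (h.hasFDerivAt_likelihoodRatio θs (hball ht)).hasFDerivWithinAt) (fun t ht => ?_)
    (convex_closedBall θs r) h2 h1
  rw [innerSL_apply_norm, norm_neg, norm_smul, Real.norm_of_nonneg (likelihoodRatio_pos _ _ _ _).le]
  have := h.likelihoodRatio_le (interior_subset hs) (hball ht) (mem_closedBall_iff_norm.1 ht)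
  have := h.norm_lossGrad_le hΘ hs (hball ht)
  gcongr

end IsRegularDatum

namespace Assumptions

variable [MeasurableSpace Y] {Θ : Set (Param p)} {f : ℝ → Y → ℝ} {P : Measure (Param p × Y)}
  {ν : Measure (Param p × Y)}
  {θs : Param p} {S : Matrix (Fin p) (Fin p) ℝ} {lam0 lam2 lamf φ : ℝ}

/-- The score has mean zero near the target: the normalization of the model, differentiated
once. -/
lemma integral_score_eq_zero [IsProbabilityMeasure P]
    (hA : Assumptions Θ f P θs S lam0 lam2 lamf φ)
    (hW : WellSpecified f P θs ν) :
    ∀ᶠ θ in 𝓝 θs, ∫ ξ, likelihoodRatio f θs θ ξ • lossGrad f θ ξ ∂P = 0 := by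
  obtain ⟨r, hr, hball⟩ := Metric.nhds_basis_closedBall.mem_iff.1
    (mem_interior_iff_mem_nhds.1 hA.target_interior)
  filter_upwards [(hW.integral_likelihoodRatio hA.measurable_loss).eventually_nhds,
    Metric.ball_mem_nhds θs hr] with θ hone hθr
  have hθb : θ ∈ Metric.closedBall θs r := Metric.ball_subset_closedBall hθr
  have hθ : θ ∈ Θ := hball hθb
  have hq : AEStronglyMeasurable (fun ξ => likelihoodRatio f θs θ ξ • lossGrad f θ ξ) P :=
    (measurable_likelihoodRatio hA.measurable_loss θs θ).aestronglyMeasurable.smul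
      (hA.aestronglyMeasurable_lossGrad hθ)
  have hqi : Integrable (fun ξ => likelihoodRatio f θs θ ξ • lossGrad f θ ξ) P := by
    refine .of_bound hq (Real.exp (|lam0| * r) * |lam0|) ?_
    filter_upwards [hA.ae_isRegularDatum] with ξ hξ
    rw [norm_smul, Real.norm_of_nonneg (likelihoodRatio_pos _ _ _ _).le]
    have := hξ.likelihoodRatio_le hA.target_mem hθ (mem_closedBall_iff_norm.1 hθb)
    have := hξ.norm_lossGrad_le hA.convex_space hA.target_interior hθ
    gcongr
  have hint : Integrable (likelihoodRatio f θs θ) P := by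
    refine .of_bound (measurable_likelihoodRatio hA.measurable_loss θs θ).aestronglyMeasurable
      (Real.exp (|lam0| * r)) ?_
    filter_upwards [hA.ae_isRegularDatum] with ξ hξ
    rw [Real.norm_of_nonneg (likelihoodRatio_pos _ _ _ _).le]
    exact hξ.likelihoodRatio_le hA.target_mem hθ (mem_closedBall_iff_norm.1 hθb)
  obtain ⟨hi, hd⟩ := hasFDerivAt_integral_of_dominated_loc_of_lip (𝕜 := ℝ) (μ := P)
    (F := fun t ξ => likelihoodRatio f θs t ξ) (x₀ := θ)
    (bound := fun _ => Real.exp (|lam0| * r) * |lam0|) (s := Metric.closedBall θs r)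
    (F' := fun ξ => innerSL ℝ (-(likelihoodRatio f θs θ ξ • lossGrad f θ ξ)))
    (mem_of_superset (Metric.isOpen_ball.mem_nhds hθr) Metric.ball_subset_closedBall)
    (Eventually.of_forall fun t =>
      (measurable_likelihoodRatio hA.measurable_loss θs t).aestronglyMeasurable)
    hint ((innerSL ℝ).continuous.comp_aestronglyMeasurable hq.neg)
    (by
      filter_upwards [hA.ae_isRegularDatum] with ξ hξ
      refine LipschitzOnWith.of_dist_le_mul fun t₁ h1 t₂ h2 => ?_
      rw [Real.dist_eq, dist_eq_norm, Real.coe_nnabs,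
        abs_of_nonneg (by positivity : 0 ≤ Real.exp (|lam0| * r) * |lam0|)]
      exact hξ.abs_likelihoodRatio_sub_le hA.convex_space hA.target_interior hball h1 h2)
    (integrable_const _)
    (by
      filter_upwards [hA.ae_isRegularDatum] with ξ hξ
      exact hξ.hasFDerivAt_likelihoodRatio θs hθ)
  have hzero := hd.unique ((hasFDerivAt_const (1 : ℝ) θ).congr_of_eventuallyEq hone)
  refine ext_inner_right ℝ fun v => ?_
  have hv := congrArg (fun A : Param p →L[ℝ] ℝ => A v) hzero
  simp only [ContinuousLinearMap.integral_apply hi, innerSL_apply_apply, inner_neg_left,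
    integral_neg, zero_apply, neg_eq_zero] at hv
  rw [inner_zero_left, real_inner_comm, ← integral_inner hqi, ← hv]
  simp only [real_inner_comm]

/-- The information identity: the normalization of the model, differentiated twice, equates the
mean Hessian of the loss and the second moment of its gradient. -/
lemma integral_hessianOp_apply_eq [IsProbabilityMeasure P]
    (hA : Assumptions Θ f P θs S lam0 lam2 lamf φ)
    (hW : WellSpecified f P θs ν) (v : Param p) :
    hessianOp (expectedLoss f P) θs v
      = ∫ ξ, (inner ℝ (lossGrad f θs ξ) v : ℝ) • lossGrad f θs ξ ∂P := by
  obtain ⟨r, K, hr, hball, hK, hlip⟩ := hA.exists_lipschitzOnWith_lossGrad hA.target_interior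
  set B := Real.exp (|lam0| * r) with hB
  have hg := hA.aestronglyMeasurable_lossGrad hA.target_mem
  have hinner : ∀ v : Param p, AEStronglyMeasurable
      (fun ξ => (inner ℝ (lossGrad f θs ξ) v : ℝ) • lossGrad f θs ξ) P := by
    intro v
    have h1 : AEStronglyMeasurable (fun ξ => (inner ℝ (lossGrad f θs ξ) v : ℝ)) P :=
      hg.inner aestronglyMeasurable_const
    exact h1.smul hg
  have hM := hA.integrable_hessianOp hA.target_interior
  obtain ⟨hi, hd⟩ := hasFDerivAt_integral_of_dominated_loc_of_lip (𝕜 := ℝ) (μ := P)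
    (F := fun t ξ => likelihoodRatio f θs t ξ • lossGrad f t ξ) (x₀ := θs)
    (bound := fun _ => B * |lam0| * |lam0| + B * K) (s := Metric.closedBall θs r)
    (F' := fun ξ => hessianOp (fun t => loss f t ξ) θs
      - (innerSL ℝ (lossGrad f θs ξ)).smulRight (lossGrad f θs ξ))
    (Metric.closedBall_mem_nhds θs hr)
    (by
      filter_upwards [Metric.closedBall_mem_nhds θs hr] with t ht
      exact (measurable_likelihoodRatio hA.measurable_loss θs t).aestronglyMeasurable.smul
        (hA.aestronglyMeasurable_lossGrad (hball ht)))
    (by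
      simp only [likelihoodRatio_self, one_smul]
      exact hA.integrable_lossGrad hA.target_mem)
    (hM.1.sub (aestronglyMeasurable_of_apply fun v => by simpa using hinner v))
    (by
      filter_upwards [hA.ae_isRegularDatum] with ξ hξ
      refine LipschitzOnWith.of_dist_le_mul fun t₁ h1 t₂ h2 => ?_
      rw [dist_eq_norm, dist_eq_norm, Real.coe_nnabs,
        abs_of_nonneg (by positivity : 0 ≤ B * |lam0| * |lam0| + B * K)]
      have e : likelihoodRatio f θs t₁ ξ • lossGrad f t₁ ξ
          - likelihoodRatio f θs t₂ ξ • lossGrad f t₂ ξ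
          = (likelihoodRatio f θs t₁ ξ - likelihoodRatio f θs t₂ ξ) • lossGrad f t₁ ξ
            + likelihoodRatio f θs t₂ ξ • (lossGrad f t₁ ξ - lossGrad f t₂ ξ) := by module
      rw [e, add_mul]
      refine (norm_add_le _ _).trans (add_le_add ?_ ?_)
      · rw [norm_smul, Real.norm_eq_abs, mul_right_comm]
        exact mul_le_mul (hξ.abs_likelihoodRatio_sub_le hA.convex_space hA.target_interior hball
          h1 h2) (hξ.norm_lossGrad_le hA.convex_space hA.target_interior (hball h1))
          (norm_nonneg _) (by positivity)
      · rw [norm_smul, Real.norm_of_nonneg (likelihoodRatio_pos _ _ _ _).le, mul_assoc]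
        exact mul_le_mul (hξ.likelihoodRatio_le hA.target_mem (hball h2)
          (mem_closedBall_iff_norm.1 h2)) (hlip ξ hξ t₁ h1 t₂ h2) (norm_nonneg _)
          (by positivity))
    (integrable_const _)
    (by
      filter_upwards [hA.ae_isRegularDatum] with ξ hξ
      refine ((hξ.hasFDerivAt_likelihoodRatio θs hA.target_mem).smul
        (hξ.hasFDerivAt_grad hA.target_mem)).congr_fderiv ?_
      ext1 v
      simp [likelihoodRatio_self, sub_eq_add_neg])
  have hzero := hd.unique ((hasFDerivAt_const (0 : Param p) θs).congr_of_eventuallyEq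
    (hA.integral_score_eq_zero hW))
  have hv := congrArg (fun A : Param p →L[ℝ] Param p => A v) hzero
  have hvi : Integrable (fun ξ => (inner ℝ (lossGrad f θs ξ) v : ℝ) • lossGrad f θs ξ) P := by
    refine ((hM.sub hi).apply_continuousLinearMap v).congr (Eventually.of_forall fun ξ => ?_)
    simp
  simp only [ContinuousLinearMap.integral_apply hi, sub_apply,
    ContinuousLinearMap.smulRight_apply, innerSL_apply_apply, zero_apply] at hv
  rw [integral_sub (hM.apply_continuousLinearMap v) hvi, sub_eq_zero] at hv
  rw [hA.hessianOp_expectedLoss hA.target_interior, ContinuousLinearMap.integral_apply hM, hv]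

lemma fisherInfo_eq_hessianMat [IsProbabilityMeasure P]
    (hA : Assumptions Θ f P θs S lam0 lam2 lamf φ)
    (hW : WellSpecified f P θs ν) :
    fisherInfo f ν θs = hessianMat (expectedLoss f P) θs := by
  ext i j
  have hvi : Integrable (fun ξ => (inner ℝ (lossGrad f θs ξ) (EuclideanSpace.single j 1) : ℝ) •
      lossGrad f θs ξ) P := by
    have hg := hA.aestronglyMeasurable_lossGrad hA.target_mem
    have h1 : AEStronglyMeasurable
        (fun ξ => (inner ℝ (lossGrad f θs ξ) (EuclideanSpace.single j 1) : ℝ)) P :=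
      hg.inner aestronglyMeasurable_const
    refine .of_bound (h1.smul hg) (|lam0| * |lam0|) ?_
    filter_upwards [hA.ae_norm_lossGrad_le hA.target_mem] with ξ hξ
    rw [norm_smul]
    have h1 := norm_inner_le_norm (𝕜 := ℝ) (lossGrad f θs ξ) (EuclideanSpace.single j 1)
    have hone : ‖(EuclideanSpace.single j 1 : Param p)‖ = 1 := by simp
    rw [hone, mul_one] at h1
    exact mul_le_mul (h1.trans hξ) hξ (norm_nonneg _) (abs_nonneg _)
  have h := (EuclideanSpace.proj (𝕜 := ℝ) i).integral_comp_comm hvi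
  rw [hW.fisherInfo_apply hA.measurable_loss, hessianMat, Matrix.of_apply,
    hA.integral_hessianOp_apply_eq hW]
  refine Eq.trans ?_ h
  refine integral_congr_ae (Eventually.of_forall fun ξ => ?_)
  simp [EuclideanSpace.inner_single_right, mul_comm]

/-- With the Fisher information as Hessian and as noise covariance the leading term is the
Cramér–Rao bound. -/
lemma leadingTerm_eq_sqrt_cramerRaoBound [IsProbabilityMeasure P]
    (hA : Assumptions Θ f P θs S lam0 lam2 lamf φ)
    (hW : WellSpecified f P θs ν) (hSn : S = noiseCov f P θs) (n : ℕ) :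
    leadingTerm (hessianMat (expectedLoss f P) θs) S n
      = √(cramerRaoBound (fisherInfo f ν θs) n) := by
  have hSH : S = hessianMat (expectedLoss f P) θs := by
    rw [hSn, ← hA.fisherInfo_eq_hessianMat hW]
    ext i j
    rw [hA.noiseCov_target_apply, hW.fisherInfo_apply hA.measurable_loss]
  have hdet := hA.isUnit_det_hessianMat
  rw [leadingTerm, cramerRaoBound, hA.fisherInfo_eq_hessianMat hW, hSH,
    Matrix.nonsing_inv_mul _ hdet, one_mul]
  rcases Nat.eq_zero_or_pos n with rfl | hn
  · have : (0 : ℝ) ^ (-(1 / 2) : ℝ) = 0 := Real.zero_rpow (by norm_num)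
    simp only [Nat.cast_zero, this, zero_mul, zero_smul]
    rw [Matrix.inv_zero]
    simp
  have hn0 : (0 : ℝ) < n := by exact_mod_cast hn
  have hinv : ((n : ℝ) • hessianMat (expectedLoss f P) θs)⁻¹
      = (n : ℝ)⁻¹ • (hessianMat (expectedLoss f P) θs)⁻¹ := by
    apply Matrix.inv_eq_left_inv
    rw [Matrix.smul_mul, Matrix.mul_smul, smul_smul, inv_mul_cancel₀ hn0.ne', one_smul,
      Matrix.nonsing_inv_mul _ hdet]
  rw [hinv, Matrix.trace_smul, smul_eq_mul, Real.sqrt_mul (by positivity),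
    Real.sqrt_eq_rpow (n : ℝ)⁻¹, ← Real.rpow_neg_one, ← Real.rpow_mul hn0.le]
  norm_num

lemma one_lt_decayConst (hA : Assumptions Θ f P θs S lam0 lam2 lamf φ) {γ1 : ℝ}
    (hγ1 : 0 < γ1) : 1 < decayConst γ1 lamf φ := by
  have h1 := hA.lamf_pos
  have h2 : 0 ≤ φ - lamf := sub_nonneg.2 hA.lamf_le
  have : 0 < γ1 * lamf * (1 + γ1 * (φ - lamf))⁻¹ := by positivity
  rw [decayConst]
  linarith

end Assumptions

end AISGD

/-! ### The error bound and the optimal rates -/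

theorem theorem2 {p : ℕ} {Y : Type*} [MeasurableSpace Y]
    (Θ : Set (AISGD.Param p)) (f : ℝ → Y → ℝ)
    (P : Measure (AISGD.Param p × Y)) [IsProbabilityMeasure P]
    (θs : AISGD.Param p) (S : Matrix (Fin p) (Fin p) ℝ) (lam0 lam2 lamf φ : ℝ)
    (hA : AISGD.Assumptions Θ f P θs S lam0 lam2 lamf φ)
    (γ1 γ : ℝ) (hγ1 : 0 < γ1) (hγ : γ ∈ Set.Ioo (1 / 2 : ℝ) 1) :
    -- the error bound; the constants depend neither on `n` nor on the initial condition
    (1 < AISGD.decayConst γ1 lamf φ ∧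
      ∃ C₁ C₂ C₃ : ℝ, ∀ {Ω : Type*} {mΩ : MeasurableSpace Ω} (μ : Measure Ω)
        [IsProbabilityMeasure μ] (ℱ : Filtration ℕ mΩ)
        (ξ : ℕ → Ω → AISGD.Param p × Y) (θ : ℕ → Ω → AISGD.Param p),
        AISGD.IsImplicitSGD Θ f P γ1 γ μ ℱ ξ θ →
        MemLp (fun ω => θ 0 ω - θs) 2 μ ∧
        ∀ n : ℕ, 1 ≤ n →
          MemLp (fun ω => AISGD.average θ n ω - θs) 2 μ ∧
          Real.sqrt (∫ ω, ‖AISGD.average θ n ω - θs‖ ^ 2 ∂μ) ≤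
            AISGD.leadingTerm (AISGD.hessianMat (AISGD.expectedLoss f P) θs) S n
              + C₁ * (n : ℝ) ^ (-1 + γ / 2)
              + C₂ * (n : ℝ) ^ (-γ)
              + C₃ * Real.sqrt (∫ ω, ‖θ 0 ω - θs‖ ^ 2 ∂μ)
                * Real.exp (-Real.log (AISGD.decayConst γ1 lamf φ) * (n : ℝ) ^ (1 - γ) / 2)) ∧
    -- in a correctly specified model the leading term is the Cramér–Rao bound
    (∀ ν : Measure (AISGD.Param p × Y), AISGD.WellSpecified f P θs ν →
      AISGD.fisherInfo f ν θs = AISGD.hessianMat (AISGD.expectedLoss f P) θs ∧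
      (S = AISGD.noiseCov f P θs → ∀ n : ℕ, 1 ≤ n →
        AISGD.leadingTerm (AISGD.hessianMat (AISGD.expectedLoss f P) θs) S n
          = Real.sqrt (AISGD.cramerRaoBound (AISGD.fisherInfo f ν θs) n))) ∧
    -- the exponent `2/3` optimizes the order of the remaining terms
    (∀ g ∈ Set.Ioo (1 / 2 : ℝ) 1, g ≠ 2 / 3 →
      AISGD.remainderOrder (2 / 3) =o[atTop] AISGD.remainderOrder g) := by
  refine ⟨⟨hA.one_lt_decayConst hγ1, ?_⟩, fun ν hW => ⟨hA.fisherInfo_eq_hessianMat hW,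
    fun hSn n _ => hA.leadingTerm_eq_sqrt_cramerRaoBound hW hSn n⟩,
    fun g _ hg => AISGD.remainderOrder_two_thirds_isLittleO hg⟩
  obtain ⟨C₁, C₂, hC⟩ := hA.exists_lpNorm_average_sub_le hγ1 hγ
  -- `Θ` is bounded, so the initial error is bounded uniformly, and its contribution to the average
  -- is `O(1/n)`; the constant `C₁` accounts for it and `C₃ = 0` is admissible
  refine ⟨C₁, C₂, 0, fun {Ω mΩ} μ _ ℱ ξ θ hS => ⟨hS.memLp_iterate_sub hA 0, fun n hn => ?_⟩⟩
  obtain ⟨m, rfl⟩ : ∃ m, n = m + 1 := ⟨n - 1, by omega⟩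
  have hL := hS.memLp_average_sub hA m
  refine ⟨hL, ?_⟩
  rw [← AISGD.lpNorm_two_eq_sqrt hL.1, zero_mul, zero_mul, add_zero]
  push_cast
  exact hC μ ℱ ξ θ hS m
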